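/- Let $Z$ and $F$ be smooth, Hausdorff, second-countable, connected manifolds without boundary. Let $\mathcal F$ be a regular foliation of $Z$, given by its tangent distribution $T\mathcal F\subset TZ$ (a smooth involutive distribution of constant rank $k=\dim F$), and let $i_F:F\to Z$ be a leaf of $\mathcal F$, i.e. an injective immersion with $di_F(T_pF)=T_{i_F(p)}\mathcal F$ for all $p\in F$ whose image contains the image of every connected integral manifold of $T\mathcal F$ that meets it. Let $\mathcal T_1(\mathcal F)$ be the Lie algebra and $C^\infty(Z)$-module of global smooth sections of $T\mathcal F$, let $S_{\mathcal F}(Z)=\{f\in C^\infty(Z): Xf=0 \text{ for all } X\in\mathcal T_1(\mathcal F)\}$, and let $\mathfrak F^r(Z)$ be the space of leafwise $r$-forms, i.e. of $C^\infty(Z)$-multilinear alternating maps $\mathcal T_1(\mathcal F)^r\to C^\infty(Z)$. With the Chevalley–Eilenberg differential $$\widetilde d\phi(X_0,\dots,X_r)=\sum_i(-1)^iX_i\,\phi(\dots,\widehat{X_i},\dots)+\sum_{i<j}(-1)^{i+j}\phi([X_i,X_j],\dots,\widehat{X_i},\dots,\widehat{X_j},\dots)$$ these form the leafwise de Rham complex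 $(\mathfrak F^*(Z),\widetilde d)$, with cohomology $H^*_{\mathcal F}(Z)$. Let $(\mathcal O^*(Z),d)$ and $(\mathcal O^*(F),d)$ be the de Rham complexes, with cohomology $H^*(Z)$ and $H^*(F)$, and let $i^*_{\mathcal F}:\mathcal O^*(Z)\to\mathfrak F^*(Z)$ be the cochain morphism which restricts exterior forms to vector fields in $\mathcal T_1(\mathcal F)$. Then the pull-back of exterior forms along $i_F$ is a cochain morphism $\mathcal O^*(Z)\to\mathcal O^*(F)$. The pull-back of leafwise forms, $(i_F^*\phi)_p(v_1,\dots,v_r)=\phi_{i_F(p)}(di_Fv_1,\dots,di_Fv_r)$, is a well-defined cochain morphism $i_F^*:\mathfrak F^*(Z)\to\mathcal O^*(F)$, which takes every $f\in S_{\mathcal F}(Z)$ to a constant function $\varepsilon(f)$, where $\varepsilon:S_{\mathcal F}(Z)\to\mathbb R$ is a homomorphism of $\mathbb R$-algebras. The pull-back morphism of de Rham complexes factorizes as $$\mathcal O^*(Z)\xrightarrow{\;i^*_{\mathcal F}\;}\mathfrak F^*(Z)\xrightarrow{\;i_F^*\;}\mathcal O^*(F),$$ and, consequently, the homomorphism $H^*(Z)\to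 H^*(F)$ factorizes as $$H^*(Z)\xrightarrow{\;[i^*_{\mathcal F}]\;}H^*_{\mathcal F}(Z)\xrightarrow{\;[i_F^*]\;}H^*(F)$$ in every degree. -/

import Mathlib

set_option linter.unusedSectionVars false

open scoped Manifold ContDiff
open VectorField CategoryTheory

universe u

noncomputable section

namespace LieRinehart

section CE

open Function

variable {A L : Type*} [CommRing A] [LieRing L] [Module A L] [LieRingModule L A]
  [LieRinehartRing A L] {r : ℕ}

lemma sum_update_aux (φ : L [⋀^Fin r]→ₗ[A] A) (X : L) (Y : Fin r → L) (i : Fin r) (z : L) :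
    ∑ j, φ (update (update Y i z) j ⁅X, update Y i z j⁆) =
      φ (update Y i ⁅X, z⁆) +
        ∑ j ∈ Finset.univ.erase i, φ (update (update Y j ⁅X, Y j⁆) i z) := by
  rw [← Finset.add_sum_erase _ _ (Finset.mem_univ i)]
  congr 1
  · simp
  · refine Finset.sum_congr rfl fun j hj => ?_
    have hj' := Finset.ne_of_mem_erase hj
    rw [update_of_ne hj', update_comm hj']

/-- The Lie derivative `(L_X φ)(Y) = X(φ(Y)) - ∑ j, φ(Y₁, …, [X, Y_j], …, Y_r)`. -/
def lieDeriv (X : L) (φ : L [⋀^Fin r]→ₗ[A] A) : L [⋀^Fin r]→ₗ[A] A where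
  toFun Y := ⁅X, φ Y⁆ - ∑ j, φ (update Y j ⁅X, Y j⁆)
  map_update_add' {inst} Y i x y := by
    rw [Subsingleton.elim inst (instDecidableEqFin r)]
    simp only [sum_update_aux, φ.map_update_add, lie_add, Finset.sum_add_distrib]
    abel
  map_update_smul' {inst} Y i f x := by
    rw [Subsingleton.elim inst (instDecidableEqFin r)]
    simp only [sum_update_aux, φ.map_update_add, φ.map_update_smul,
      LieRinehartRing.leibniz_smul_right,
      smul_eq_mul, LieRinehartRing.leibniz_mul_right, ← Finset.mul_sum]
    ring
  map_eq_zero_of_eq' Y a b hab hne := by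
    rw [φ.map_eq_zero_of_eq Y hab hne, lie_zero, zero_sub, neg_eq_zero]
    rw [← Finset.add_sum_erase _ _ (Finset.mem_univ a),
      ← Finset.add_sum_erase _ _ (Finset.mem_erase.2 ⟨hne.symm, Finset.mem_univ b⟩),
      Finset.sum_eq_zero, add_zero]
    · have : update Y b ⁅X, Y b⁆ = (update Y a ⁅X, Y a⁆) ∘ Equiv.swap a b := by
        funext j
        by_cases hja : j = a
        · subst hja; simp [hne, hab, hne.symm]
        by_cases hjb : j = b
        · subst hjb; simp [hab]
        simp [Equiv.swap_apply_of_ne_of_ne hja hjb, hja, hjb]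
      rw [this, φ.map_swap _ hne, add_neg_cancel]
    · intro j hj
      simp only [Finset.mem_erase, Finset.mem_univ, and_true] at hj
      exact φ.map_eq_zero_of_eq _ (by simp [hj.1.symm, hj.2.symm, hab]) hne

lemma lieDeriv_apply (X : L) (φ : L [⋀^Fin r]→ₗ[A] A) (Y : Fin r → L) :
    lieDeriv X φ Y = ⁅X, φ Y⁆ - ∑ j, φ (update Y j ⁅X, Y j⁆) := rfl

/-- The Chevalley–Eilenberg (Koszul) formula
`∑ i, (-1)^i X_i(φ(X₀, …, X̂_i, …, X_r)) + ∑ i < j, (-1)^(i+j) φ([X_i, X_j], …, X̂_i, …, X̂_j, …)`.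
In the second sum `[X_i, X_j]` is written in the place of `X_j` instead of the first place, which
turns the sign `(-1)^(i+j)` into `-(-1)^i`; after removal of `X_i`, the vector `X_(j+1)` with
`i ≤ j` stands in the place number `j`. -/
def koszul (φ : L [⋀^Fin r]→ₗ[A] A) (X : Fin (r + 1) → L) : A :=
  ∑ i : Fin (r + 1), (-1 : A) ^ (i : ℕ) *
    (⁅X i, φ (i.removeNth X)⁆ -
      ∑ j : Fin r, if i ≤ j.castSucc then φ (update (i.removeNth X) j ⁅X i, X j.succ⁆) else 0)

lemma koszul_cons_zero (φ : L [⋀^Fin 0]→ₗ[A] A) (X : L) (Y : Fin 0 → L) :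
    koszul φ (Matrix.vecCons X Y) = lieDeriv X φ Y := by
  simp [koszul, lieDeriv_apply, Subsingleton.elim _ Y]

lemma koszul_cons (φ : L [⋀^Fin (r + 1)]→ₗ[A] A) (X : L) (Y : Fin (r + 1) → L) :
    koszul φ (Matrix.vecCons X Y) = lieDeriv X φ Y - koszul (φ.curryLeft X) Y := by
  rw [koszul, Fin.sum_univ_succ, sub_eq_add_neg (lieDeriv X φ Y), koszul, ← Finset.sum_neg_distrib]
  congr 1
  · simp [lieDeriv_apply, Matrix.vecCons]
  · refine Finset.sum_congr rfl fun i _ => ?_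
    have h1 : i.succ.removeNth (Matrix.vecCons X Y) = Matrix.vecCons X (i.removeNth Y) := by
      funext j
      refine Fin.cases ?_ (fun j => ?_) j <;> simp [Fin.removeNth_apply]
    rw [h1, Fin.val_succ, pow_succ, mul_neg_one, neg_mul, Fin.sum_univ_succ]
    have h2 : ∀ j : Fin r, update (Matrix.vecCons X (i.removeNth Y)) j.succ ⁅Y i, Y j.succ⁆ =
       Matrix.vecCons X (update (i.removeNth Y) j ⁅Y i, Y j.succ⁆) := by
      intro j; simp [Matrix.vecCons, Fin.cons_update]
    simp [h2, Fin.le_def]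

lemma koszul_add (φ ψ : L [⋀^Fin r]→ₗ[A] A) (X : Fin (r + 1) → L) :
    koszul (φ + ψ) X = koszul φ X + koszul ψ X := by
  simp only [koszul, ← Finset.sum_add_distrib, ← mul_add]
  refine Finset.sum_congr rfl fun i _ => ?_
  congr 1
  simp only [AlternatingMap.add_apply, lie_add]
  rw [sub_add_sub_comm, ← Finset.sum_add_distrib]
  congr 1
  refine Finset.sum_congr rfl fun j _ => ?_
  split_ifs <;> simp

lemma koszul_smul (f : A) (φ : L [⋀^Fin r]→ₗ[A] A) (X : Fin (r + 1) → L) :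
    koszul (f • φ) X = f * koszul φ X +
      ∑ i : Fin (r + 1), (-1 : A) ^ (i : ℕ) * (⁅X i, f⁆ * φ (i.removeNth X)) := by
  simp only [koszul, Finset.mul_sum, ← Finset.sum_add_distrib]
  refine Finset.sum_congr rfl fun i _ => ?_
  have : (∑ j : Fin r, if i ≤ j.castSucc then
      (f • φ) (update (i.removeNth X) j ⁅X i, X j.succ⁆) else 0) =
      f * ∑ j : Fin r, if i ≤ j.castSucc then φ (update (i.removeNth X) j ⁅X i, X j.succ⁆) else 0 := by
    rw [Finset.mul_sum]
    refine Finset.sum_congr rfl fun j _ => ?_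
    split_ifs <;> simp
  rw [this]
  simp only [AlternatingMap.smul_apply, smul_eq_mul, LieRinehartRing.leibniz_mul_right]
  ring

lemma sum_removeNth_aux (φ : L [⋀^Fin (r + 1)]→ₗ[A] A) (g : Fin (r + 1) → A) (X : L)
    (Y : Fin (r + 1) → L) :
    ∑ i : Fin (r + 1), (-1 : A) ^ (i : ℕ) * (g i * φ (Matrix.vecCons X (i.removeNth Y))) =
      ∑ i, g i * φ (update Y i X) := by
  refine Finset.sum_congr rfl fun i _ => ?_
  have := φ.map_insertNth i X (i.removeNth Y)
  rw [Fin.insertNth_removeNth] at this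
  rw [this]
  rw [show ∀ a : A, ((-1 : ℤ) ^ (i : ℕ)) • a = (-1 : A) ^ (i : ℕ) * a from fun a => by simp]
  ring

lemma lieDeriv_smul_left (f : A) (X : L) (φ : L [⋀^Fin r]→ₗ[A] A) (Y : Fin r → L) :
    lieDeriv (f • X) φ Y = f * lieDeriv X φ Y + ∑ i, ⁅Y i, f⁆ * φ (update Y i X) := by
  have h : ∀ j, ⁅f • X, Y j⁆ = f • ⁅X, Y j⁆ + -⁅Y j, f⁆ • X := by
    intro j
    rw [← lie_skew, LieRinehartRing.leibniz_smul_right, ← lie_skew X (Y j), smul_neg, neg_add,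
      neg_smul]
  simp only [lieDeriv_apply, LieRinehartRing.lie_smul_eq_mul, h, φ.map_update_add,
    φ.map_update_smul, Finset.sum_add_distrib, smul_eq_mul, ← Finset.mul_sum, neg_mul,
    Finset.sum_neg_distrib]
  ring

lemma lieDeriv_add_left (X X' : L) (φ : L [⋀^Fin r]→ₗ[A] A) (Y : Fin r → L) :
    lieDeriv (X + X') φ Y = lieDeriv X φ Y + lieDeriv X' φ Y := by
  simp only [lieDeriv_apply, add_lie, φ.map_update_add, Finset.sum_add_distrib]
  ring

lemma koszul_cons_add (φ : L [⋀^Fin r]→ₗ[A] A) (X X' : L) (Y : Fin r → L) :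
    koszul φ (Matrix.vecCons (X + X') Y) =
      koszul φ (Matrix.vecCons X Y) + koszul φ (Matrix.vecCons X' Y) := by
  cases r with
  | zero => simp only [koszul_cons_zero, lieDeriv_add_left]
  | succ r => simp only [koszul_cons, lieDeriv_add_left, map_add, koszul_add]; ring

lemma koszul_cons_smul (φ : L [⋀^Fin r]→ₗ[A] A) (f : A) (X : L) (Y : Fin r → L) :
    koszul φ (Matrix.vecCons (f • X) Y) = f * koszul φ (Matrix.vecCons X Y) := by
  cases r with
  | zero => simp [koszul_cons_zero, lieDeriv_smul_left]
  | succ r =>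
    simp only [koszul_cons, lieDeriv_smul_left, map_smul, koszul_smul,
      AlternatingMap.curryLeft_apply_apply]
    rw [sum_removeNth_aux φ (fun i => ⁅Y i, f⁆)]
    ring

lemma update_cons_succ (X : L) (Y : Fin r → L) (i : Fin r) (z : L) :
    update (Matrix.vecCons X Y) i.succ z = Matrix.vecCons X (update Y i z) := by
  simp [Matrix.vecCons, Fin.cons_update]

lemma update_cons_zero (X : L) (Y : Fin r → L) (z : L) :
    update (Matrix.vecCons X Y) 0 z = Matrix.vecCons z Y := by
  simp [Matrix.vecCons]

lemma koszul_update_add (φ : L [⋀^Fin r]→ₗ[A] A) (X : Fin (r + 1) → L) (i : Fin (r + 1))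
    (x y : L) : koszul φ (update X i (x + y)) = koszul φ (update X i x) + koszul φ (update X i y) := by
  induction r with
  | zero =>
    obtain rfl : i = 0 := Fin.fin_one_eq_zero i
    rw [← Matrix.cons_head_tail X]
    simp only [update_cons_zero, koszul_cons_add]
  | succ r ih =>
    rw [← Matrix.cons_head_tail X]
    refine Fin.cases ?_ (fun i => ?_) i
    · simp only [update_cons_zero, koszul_cons_add]
    · simp only [update_cons_succ, koszul_cons, AlternatingMap.map_update_add, ih]
      ring

lemma koszul_update_smul (φ : L [⋀^Fin r]→ₗ[A] A) (X : Fin (r + 1) → L) (i : Fin (r + 1))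
    (f : A) (x : L) : koszul φ (update X i (f • x)) = f * koszul φ (update X i x) := by
  induction r with
  | zero =>
    obtain rfl : i = 0 := Fin.fin_one_eq_zero i
    rw [← Matrix.cons_head_tail X]
    simp only [update_cons_zero, koszul_cons_smul]
  | succ r ih =>
    rw [← Matrix.cons_head_tail X]
    refine Fin.cases ?_ (fun i => ?_) i
    · simp only [update_cons_zero, koszul_cons_smul]
    · simp only [update_cons_succ, koszul_cons, AlternatingMap.map_update_smul, ih, smul_eq_mul]
      ring

lemma curryLeft_lieDeriv (X Y : L) (φ : L [⋀^Fin (r + 1)]→ₗ[A] A) :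
    (lieDeriv X φ).curryLeft Y = lieDeriv X (φ.curryLeft Y) - φ.curryLeft ⁅X, Y⁆ := by
  ext Z
  simp only [AlternatingMap.curryLeft_apply_apply, lieDeriv_apply, Fin.sum_univ_succ,
    AlternatingMap.sub_apply, update_cons_succ, update_cons_zero, Matrix.cons_val_zero,
    Matrix.cons_val_succ]
  ring

/-- vanishing on two equal leading arguments -/
lemma koszul_cons_cons_self (φ : L [⋀^Fin (r + 1)]→ₗ[A] A) (X : L) (Y : Fin r → L) :
    koszul φ (Matrix.vecCons X (Matrix.vecCons X Y)) = 0 := by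
  have h := congrArg (fun ψ => ψ Y) (curryLeft_lieDeriv X X φ)
  simp only [lie_self, map_zero, sub_zero, AlternatingMap.curryLeft_apply_apply] at h
  rw [koszul_cons, h]
  cases r with
  | zero => rw [koszul_cons_zero, sub_self]
  | succ r =>
    rw [koszul_cons, AlternatingMap.curryLeft_same, sub_sub_cancel]
    simp [koszul]

lemma koszul_cons_cons_swap (φ : L [⋀^Fin (r + 1)]→ₗ[A] A) (X X' : L) (Y : Fin r → L) :
    koszul φ (Matrix.vecCons X (Matrix.vecCons X' Y)) =
      - koszul φ (Matrix.vecCons X' (Matrix.vecCons X Y)) := by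
  have h := koszul_cons_cons_self φ (X + X') Y
  have h1 : ∀ Z : L, koszul φ (Matrix.vecCons Z (Matrix.vecCons (X + X') Y)) =
      koszul φ (Matrix.vecCons Z (Matrix.vecCons X Y)) +
        koszul φ (Matrix.vecCons Z (Matrix.vecCons X' Y)) := by
    intro Z
    have := koszul_update_add φ (Matrix.vecCons Z (Matrix.vecCons X Y)) (Fin.succ 0) X X'
    simpa only [update_cons_succ, update_cons_zero] using this
  rw [koszul_cons_add, h1, h1, koszul_cons_cons_self, koszul_cons_cons_self] at h
  linear_combination h

lemma koszul_eq_zero (φ : L [⋀^Fin r]→ₗ[A] A) (X : Fin (r + 1) → L) (i j : Fin (r + 1))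
    (hij : X i = X j) (hlt : i < j) : koszul φ X = 0 := by
  induction r with
  | zero => exact absurd hlt (by rw [Fin.fin_one_eq_zero i, Fin.fin_one_eq_zero j]; exact lt_irrefl _)
  | succ r ih =>
    have key : ∀ (Z : L) (Y : Fin (r + 1) → L) (a b : Fin (r + 1)), a < b → Y a = Y b →
        koszul φ (Matrix.vecCons Z Y) = 0 := by
      intro Z Y a b hab h
      rw [koszul_cons, AlternatingMap.map_eq_zero_of_eq _ _ h hab.ne, ih _ _ a b h hab, sub_zero]
    obtain ⟨j, rfl⟩ := Fin.exists_succ_eq.2 (Fin.ne_zero_of_lt hlt)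
    rw [← Matrix.cons_head_tail X] at hij ⊢
    rcases Fin.eq_zero_or_eq_succ i with rfl | ⟨i, rfl⟩
    · rw [← Matrix.cons_head_tail (Matrix.vecTail X)] at hij ⊢
      rcases Fin.eq_zero_or_eq_succ j with rfl | ⟨j, rfl⟩
      · simp only [Matrix.cons_val_zero, Matrix.cons_val_succ] at hij
        rw [← hij]
        exact koszul_cons_cons_self _ _ _
      · rw [koszul_cons_cons_swap, key _ _ 0 j.succ (Fin.succ_pos _) hij, neg_zero]
    · exact key _ _ i j (Fin.succ_lt_succ_iff.1 hlt) (by simpa using hij)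

/-- The Chevalley–Eilenberg differential. -/
def ceD (φ : L [⋀^Fin r]→ₗ[A] A) : L [⋀^Fin (r + 1)]→ₗ[A] A where
  toFun := koszul φ
  map_update_add' {inst} X i x y := by
    rw [Subsingleton.elim inst (instDecidableEqFin _)]
    exact koszul_update_add φ X i x y
  map_update_smul' {inst} X i f x := by
    rw [Subsingleton.elim inst (instDecidableEqFin _)]
    exact koszul_update_smul φ X i f x
  map_eq_zero_of_eq' X i j hij hne := by
    rcases lt_or_gt_of_ne hne with h | h
    · exact koszul_eq_zero φ X i j hij h
    · exact koszul_eq_zero φ X j i hij.symm h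

lemma ceD_apply (φ : L [⋀^Fin r]→ₗ[A] A) (X : Fin (r + 1) → L) : ceD φ X = koszul φ X := rfl

lemma curryLeft_ceD (φ : L [⋀^Fin (r + 1)]→ₗ[A] A) (X : L) :
    (ceD φ).curryLeft X = lieDeriv X φ - ceD (φ.curryLeft X) := by
  ext Y; exact koszul_cons φ X Y

lemma curryLeft_ceD_zero (φ : L [⋀^Fin 0]→ₗ[A] A) (X : L) :
    (ceD φ).curryLeft X = lieDeriv X φ := by
  ext Y; exact koszul_cons_zero φ X Y

lemma ceD_add (φ ψ : L [⋀^Fin r]→ₗ[A] A) : ceD (φ + ψ) = ceD φ + ceD ψ := by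
  ext X; exact koszul_add φ ψ X

lemma ceD_sub (φ ψ : L [⋀^Fin r]→ₗ[A] A) : ceD (φ - ψ) = ceD φ - ceD ψ := by
  rw [eq_sub_iff_add_eq, ← ceD_add, sub_add_cancel]

lemma ext_curryLeft {φ ψ : L [⋀^Fin (r + 1)]→ₗ[A] A} (h : ∀ X, φ.curryLeft X = ψ.curryLeft X) :
    φ = ψ := by
  ext X
  have := congrArg (fun η => η (Matrix.vecTail X)) (h (Matrix.vecHead X))
  simpa using this

lemma lieDeriv_sub (X : L) (φ ψ : L [⋀^Fin r]→ₗ[A] A) :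
    lieDeriv X (φ - ψ) = lieDeriv X φ - lieDeriv X ψ := by
  ext Y
  simp only [lieDeriv_apply, AlternatingMap.sub_apply, lie_sub, Finset.sum_sub_distrib]
  ring

lemma lieDeriv_lie (X Y : L) (φ : L [⋀^Fin r]→ₗ[A] A) :
    lieDeriv ⁅X, Y⁆ φ = lieDeriv X (lieDeriv Y φ) - lieDeriv Y (lieDeriv X φ) := by
  induction r with
  | zero => ext Z; simp [lieDeriv_apply]
  | succ r ih =>
    refine ext_curryLeft fun Z => ?_
    have hs : ∀ a b : L [⋀^Fin (r + 1)]→ₗ[A] A, (a - b).curryLeft Z =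
      a.curryLeft Z - b.curryLeft Z := fun _ _ => rfl
    simp only [hs, curryLeft_lieDeriv, lieDeriv_sub, ih, lie_lie, map_sub]
    abel

lemma ceD_lieDeriv (X : L) (φ : L [⋀^Fin r]→ₗ[A] A) :
    ceD (lieDeriv X φ) = lieDeriv X (ceD φ) := by
  induction r with
  | zero =>
    refine ext_curryLeft fun Y => ?_
    rw [curryLeft_ceD_zero, curryLeft_lieDeriv, curryLeft_ceD_zero, curryLeft_ceD_zero,
      lieDeriv_lie, sub_sub_cancel]
  | succ r ih =>
    refine ext_curryLeft fun Y => ?_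
    rw [curryLeft_ceD, curryLeft_lieDeriv, curryLeft_lieDeriv, curryLeft_ceD, curryLeft_ceD,
      lieDeriv_lie, ceD_sub, lieDeriv_sub, ih]
    abel

theorem ceD_ceD (φ : L [⋀^Fin r]→ₗ[A] A) : ceD (ceD φ) = 0 := by
  induction r with
  | zero =>
    refine ext_curryLeft fun Y => ?_
    rw [curryLeft_ceD, curryLeft_ceD_zero, ceD_lieDeriv, sub_self]; rfl
  | succ r ih =>
    refine ext_curryLeft fun Y => ?_
    rw [curryLeft_ceD, curryLeft_ceD, ceD_sub, ih, ceD_lieDeriv, sub_zero, sub_self]; rfl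

end CE

section Complex

variable (R : Type*) {A L : Type*} [CommRing R] [CommRing A] [Algebra R A] [LieRing L]
  [LieAlgebra R L] [Module A L] [LieRingModule L A] [LieRinehartRing A L]
  [LieRinehartAlgebra R A L] {r : ℕ}

lemma lie_algebraMap (X : L) (c : R) : ⁅X, algebraMap R A c⁆ = 0 := by
  have h : ⁅X, (1 : A)⁆ = 0 := by
    have := LieRinehartRing.leibniz_mul_right X (1 : A) 1
    simpa using this
  have h2 : ⁅X, c • (1 : A)⁆ = c • ⁅X, (1 : A)⁆ :=
    (LieRinehartAlgebra.toLieModule (R := R) (A := A) (L := L)).lie_smul c X 1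
  rw [Algebra.algebraMap_eq_smul_one, h2, h, smul_zero]

/-- The Chevalley–Eilenberg differential as an `R`-linear map. -/
def ceDLinear (A L : Type*) [CommRing A] [Algebra R A] [LieRing L]
    [LieAlgebra R L] [Module A L] [LieRingModule L A] [LieRinehartRing A L]
    [LieRinehartAlgebra R A L] (r : ℕ) : L [⋀^Fin r]→ₗ[A] A →ₗ[R] L [⋀^Fin (r + 1)]→ₗ[A] A where
  toFun := ceD
  map_add' := ceD_add
  map_smul' c φ := by
    ext X
    have h : c • φ = algebraMap R A c • φ := by ext Y; simp [Algebra.smul_def]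
    rw [h]
    simp [ceD_apply, koszul_smul, lie_algebraMap, Algebra.smul_def]

universe w

/-- The Chevalley–Eilenberg complex of a Lie–Rinehart algebra `L` over `A`: in degree `r` it consists
of the `A`-multilinear alternating maps `L × ⋯ × L → A` (with `r` factors). -/
def ceComplex (R : Type*) (A L : Type w) [CommRing R] [CommRing A] [Algebra R A] [LieRing L]
    [LieAlgebra R L] [Module A L] [LieRingModule L A] [LieRinehartRing A L]
    [LieRinehartAlgebra R A L] : CochainComplex (ModuleCat.{w} R) ℕ :=
  CochainComplex.of (fun r => ModuleCat.of R (L [⋀^Fin r]→ₗ[A] A))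
    (fun r => ModuleCat.ofHom (ceDLinear R A L r))
    (fun r => by
      ext φ : 2
      exact ceD_ceD φ)

lemma ceComplex_d (R : Type*) (A L : Type w) [CommRing R] [CommRing A] [Algebra R A] [LieRing L]
    [LieAlgebra R L] [Module A L] [LieRingModule L A] [LieRinehartRing A L]
    [LieRinehartAlgebra R A L] (r : ℕ) :
    (ceComplex R A L).d r (r + 1) = ModuleCat.ofHom (ceDLinear R A L r) :=
  CochainComplex.of_d (fun r => ModuleCat.of R (L [⋀^Fin r]→ₗ[A] A))
    (fun r => ModuleCat.ofHom (ceDLinear R A L r)) r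

/-- The inclusion of a Lie–Rinehart subalgebra, as an `A`-linear map. -/
def inclLinear (L' : LieRinehartSubalgebra A L) : L' →ₗ[A] L where
  toFun X := X
  map_add' _ _ := rfl
  map_smul' _ _ := rfl

lemma ceD_compLinearMap_incl (L' : LieRinehartSubalgebra A L) (φ : L [⋀^Fin r]→ₗ[A] A) :
    ceD (φ.compLinearMap (inclLinear L')) = (ceD φ).compLinearMap (inclLinear L') := by
  ext X
  have h : ∀ (i : Fin (r + 1)) (j : Fin r),
      (fun a => inclLinear L' (Function.update (i.removeNth X) j ⁅X i, X j.succ⁆ a)) =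
        Function.update (i.removeNth fun a => inclLinear L' (X a)) j
          ⁅inclLinear L' (X i), inclLinear L' (X j.succ)⁆ := by
    intro i j
    funext a
    by_cases ha : a = j
    · subst ha; simp [inclLinear]
    · simp [ha, Fin.removeNth_apply]
  simp only [ceD_apply, koszul, AlternatingMap.compLinearMap_apply, h]
  rfl

/-- Restriction of multilinear maps to a Lie–Rinehart subalgebra, as a cochain morphism. -/
def restrictHom {R : Type*} {A L : Type w} [CommRing R] [CommRing A] [Algebra R A] [LieRing L]
    [LieAlgebra R L] [Module A L] [LieRingModule L A] [LieRinehartRing A L]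
    [LieRinehartAlgebra R A L] (L' : LieRinehartSubalgebra A L) :
    ceComplex R A L ⟶ ceComplex R A L' :=
  CochainComplex.ofHom
    (fun r => ModuleCat.ofHom
      { toFun := fun φ => φ.compLinearMap (inclLinear L')
        map_add' := fun _ _ => rfl
        map_smul' := fun _ _ => rfl })
    (fun r => by
      rw [ceComplex_d, ceComplex_d]
      ext φ : 2
      exact ceD_compLinearMap_incl L' φ)

end Complex
end LieRinehart


/-- smooth functions -/
abbrev SmoothFun (n : ℕ) (M : Type*) [TopologicalSpace M] [ChartedSpace (EuclideanSpace ℝ (Fin n)) M] :=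
  C^∞⟮𝓡 n, M; ℝ⟯

/-- smooth vector fields -/
abbrev VecField (n : ℕ) (M : Type*) [TopologicalSpace M]
    [ChartedSpace (EuclideanSpace ℝ (Fin n)) M] [IsManifold (𝓡 n) ∞ M] :=
  Cₛ^∞⟮𝓡 n; EuclideanSpace ℝ (Fin n), (TangentSpace (𝓡 n) : M → Type)⟯

namespace VecField

variable {n : ℕ} {M : Type*} [TopologicalSpace M] [ChartedSpace (EuclideanSpace ℝ (Fin n)) M]
  [IsManifold (𝓡 n) ∞ M]

instance : SMul (SmoothFun n M) (VecField n M) where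
  smul f X := ⟨fun x => f x • X x, f.contMDiff.smul_section X.contMDiff⟩

@[simp] lemma smul_apply (f : SmoothFun n M) (X : VecField n M) (x : M) :
    (f • X) x = f x • X x := rfl

@[simp] lemma add_apply (X Y : VecField n M) (x : M) : (X + Y) x = X x + Y x := rfl

instance : Module (SmoothFun n M) (VecField n M) where
  one_smul X := by ext x; simp
  mul_smul f g X := by ext x; simp [mul_smul]
  smul_zero f := by ext x; simp
  smul_add f X Y := by ext x; simp
  add_smul f g X := by ext x; simp [add_smul]
  zero_smul X := by ext x; simp

instance : IsManifold (𝓡 n) (minSmoothness ℝ 2) M := by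
  rw [minSmoothness_of_isRCLikeNormedField]; infer_instance

instance : IsManifold (𝓡 n) (minSmoothness ℝ 3) M := by
  rw [minSmoothness_of_isRCLikeNormedField]; infer_instance

instance : Bracket (VecField n M) (VecField n M) where
  bracket X Y := ⟨fun x => mlieBracket (𝓡 n) X Y x,
    have : IsManifold (𝓡 n) (((⊤ : ℕ∞) : WithTop ℕ∞) + 1) M := ‹IsManifold (𝓡 n) ∞ M›
    ContDiff.mlieBracket_vectorField (m := ⊤) (n := ⊤) X.contMDiff Y.contMDiff (by simp)⟩

lemma bracket_apply (X Y : VecField n M) (x : M) :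
    ⁅X, Y⁆ x = mlieBracket (𝓡 n) X Y x := rfl

instance : Bracket (VecField n M) (SmoothFun n M) where
  bracket X f := ⟨fun x => mvfderiv (𝓡 n) f x (X x), by
    have h1 := (f.contMDiff.contMDiff_tangentMap (m := ∞) (by simp)).comp X.contMDiff
    exact (contMDiff_snd_tangentBundle_modelSpace ℝ 𝓘(ℝ, ℝ)).comp h1⟩

lemma bracket_fun_apply (X : VecField n M) (f : SmoothFun n M) (x : M) :
    ⁅X, f⁆ x = mvfderiv (𝓡 n) f x (X x) := rfl

lemma mdiffAt_fun (f : SmoothFun n M) (x : M) :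
    MDifferentiableAt (𝓡 n) 𝓘(ℝ, ℝ) f x := f.contMDiff.mdifferentiable (by simp) x

lemma contMDiffAt_min (X : VecField n M) (x : M) :
    ContMDiffAt (𝓡 n) (𝓡 n).tangent (minSmoothness ℝ 2)
      (fun y => (⟨y, X y⟩ : TangentBundle (𝓡 n) M)) x := by
  rw [minSmoothness_of_isRCLikeNormedField]
  exact X.contMDiff.contMDiffAt.of_le ENat.LEInfty.out

instance : LieRing (VecField n M) where
  add_lie X Y Z := by
    ext x; exact mlieBracket_add_left X.mdifferentiableAt Y.mdifferentiableAt
  lie_add X Y Z := by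
    ext x; exact mlieBracket_add_right Y.mdifferentiableAt Z.mdifferentiableAt
  lie_self X := by ext x; simp [bracket_apply]
  leibniz_lie X Y Z := by
    ext x
    exact leibniz_identity_mlieBracket_apply (X.contMDiffAt_min x) (Y.contMDiffAt_min x)
      (Z.contMDiffAt_min x)

instance : LieAlgebra ℝ (VecField n M) where
  lie_smul c X Y := by
    ext x; exact mlieBracket_const_smul_right Y.mdifferentiableAt

lemma leibniz_smul (X Y : VecField n M) (f : SmoothFun n M) :
    ⁅X, f • Y⁆ = f • ⁅X, Y⁆ + ⁅X, f⁆ • Y := by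
  ext x
  rw [add_apply, add_comm]
  exact mlieBracket_smul_right (mdiffAt_fun f x) Y.mdifferentiableAt

/-- `[X, Y] f = X (Y f) - Y (X f)`; derived from the Jacobi identity for `X`, `Y`, `f • W`. -/
lemma lie_lie_fun (X Y : VecField n M) (f : SmoothFun n M) :
    ⁅⁅X, Y⁆, f⁆ = ⁅X, ⁅Y, f⁆⁆ - ⁅Y, ⁅X, f⁆⁆ := by
  ext x
  change ⁅⁅X, Y⁆, f⁆ x = ⁅X, ⁅Y, f⁆⁆ x - ⁅Y, ⁅X, f⁆⁆ x
  by_cases hsub : ∀ w : TangentSpace (𝓡 n) x, w = 0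
  · simp [bracket_fun_apply, hsub]
  push Not at hsub
  obtain ⟨w, hw⟩ := hsub
  set W : Π y : M, TangentSpace (𝓡 n) y := FiberBundle.extend (EuclideanSpace ℝ (Fin n)) w with hW
  have hWx : W x = w := FiberBundle.extend_apply_self _ w
  have hWs : ContMDiffAt (𝓡 n) (𝓡 n).tangent 2 (fun y => (⟨y, W y⟩ : TangentBundle (𝓡 n) M)) x :=
    FiberBundle.contMDiffAt_extend _ _ _
  have hWe : ∀ᶠ y in nhds x, MDifferentiableAt (𝓡 n) (𝓡 n).tangent
      (fun y => (⟨y, W y⟩ : TangentBundle (𝓡 n) M)) y :=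
    ((contMDiffAt_iff_contMDiffAt_nhds (by simp)).1 hWs).mono fun y hy => hy.mdifferentiableAt (by simp)
  have hfW : ContMDiffAt (𝓡 n) (𝓡 n).tangent 2
      (fun y => (⟨y, (⇑f • W) y⟩ : TangentBundle (𝓡 n) M)) x :=
    (f.contMDiff.contMDiffAt.of_le ENat.LEInfty.out).smul_section hWs
  have key : ∀ U V : VecField n M, mlieBracket (𝓡 n) U (mlieBracket (𝓡 n) V (⇑f • W)) x =
      ⁅U, ⁅V, f⁆⁆ x • w + ⁅V, f⁆ x • mlieBracket (𝓡 n) U W x +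
        (⁅U, f⁆ x • mlieBracket (𝓡 n) V W x + f x • mlieBracket (𝓡 n) U (mlieBracket (𝓡 n) V W) x) := by
    intro U V
    have he : mlieBracket (𝓡 n) V (⇑f • W) =ᶠ[nhds x]
        ⇑⁅V, f⁆ • W + ⇑f • mlieBracket (𝓡 n) V W := by
      filter_upwards [hWe] with y hy
      exact mlieBracket_smul_right (mdiffAt_fun f y) hy
    have hVW : MDifferentiableAt (𝓡 n) (𝓡 n).tangent
        (fun y => (⟨y, mlieBracket (𝓡 n) V W y⟩ : TangentBundle (𝓡 n) M)) x := by
      have : ContMDiffAt (𝓡 n) (𝓡 n).tangent ((1 : ℕ∞) : WithTop ℕ∞)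
        (fun y => (⟨y, mlieBracket (𝓡 n) V W y⟩ : TangentBundle (𝓡 n) M)) x :=
        have : IsManifold (𝓡 n) (((2 : ℕ∞) : WithTop ℕ∞) + 1) M :=
          (inferInstance : IsManifold (𝓡 n) 3 M)
        ContMDiffAt.mlieBracket_vectorField (m := 1) (n := 2)
          (V.contMDiff.contMDiffAt.of_le ENat.LEInfty.out) hWs (by simp; norm_num)
      exact this.mdifferentiableAt (by simp)
    have hS1 : MDifferentiableAt (𝓡 n) (𝓡 n).tangent
        (fun y => (⟨y, (⇑⁅V, f⁆ • W) y⟩ : TangentBundle (𝓡 n) M)) x :=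
      (mdiffAt_fun _ x).smul_section (hWs.mdifferentiableAt (by simp))
    have hS2 : MDifferentiableAt (𝓡 n) (𝓡 n).tangent
        (fun y => (⟨y, (⇑f • mlieBracket (𝓡 n) V W) y⟩ : TangentBundle (𝓡 n) M)) x :=
      (mdiffAt_fun _ x).smul_section hVW
    rw [Filter.EventuallyEq.mlieBracket_vectorField_eq (V₁ := ⇑U) (V := ⇑U)
        (Filter.EventuallyEq.refl _ _) he,
      mlieBracket_add_right hS1 hS2, mlieBracket_smul_right (mdiffAt_fun _ x) (hWs.mdifferentiableAt (by simp)),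
      mlieBracket_smul_right (mdiffAt_fun _ x) hVW, hWx]
    rfl
  have J1 := leibniz_identity_mlieBracket_apply (X.contMDiffAt_min x) (Y.contMDiffAt_min x)
    (W := ⇑f • W) (by rw [minSmoothness_of_isRCLikeNormedField]; exact hfW)
  have J2 := leibniz_identity_mlieBracket_apply (X.contMDiffAt_min x) (Y.contMDiffAt_min x)
    (W := W) (by rw [minSmoothness_of_isRCLikeNormedField]; exact hWs)
  have h3 : mlieBracket (𝓡 n) (mlieBracket (𝓡 n) X Y) (⇑f • W) x =
      ⁅⁅X, Y⁆, f⁆ x • w + f x • mlieBracket (𝓡 n) (mlieBracket (𝓡 n) X Y) W x := by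
    rw [← hWx]
    exact mlieBracket_smul_right (mdiffAt_fun f x) (hWs.mdifferentiableAt (by simp))
  rw [key, key, h3, J2] at J1
  have : (⁅⁅X, Y⁆, f⁆ x - (⁅X, ⁅Y, f⁆⁆ x - ⁅Y, ⁅X, f⁆⁆ x)) • w = 0 := by
    rw [← sub_eq_zero] at J1
    rw [← neg_eq_zero, ← J1]
    module
  rcases smul_eq_zero.1 this with h | h
  · exact sub_eq_zero.1 h
  · exact absurd h hw

instance : LieRingModule (VecField n M) (SmoothFun n M) where
  add_lie X Y f := by ext x; simp [bracket_fun_apply]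
  lie_add X f g := by
    ext x
    simp only [bracket_fun_apply, ContMDiffMap.coe_add, Pi.add_apply]
    rw [mvfderiv_add (mdiffAt_fun f x) (mdiffAt_fun g x)]; rfl
  leibniz_lie X Y f := by rw [lie_lie_fun]; abel

instance : LieRinehartRing (SmoothFun n M) (VecField n M) where
  lie_smul_eq_mul' f g X := by ext x; simp [bracket_fun_apply]
  leibniz_mul_right' X f g := by
    ext x
    have := congrArg (fun T => T (X x)) (mvfderiv_mul (mdiffAt_fun f x) (mdiffAt_fun g x))
    simpa [bracket_fun_apply, mul_comm] using this
  leibniz_smul_right' X Y f := leibniz_smul X Y f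

instance : LieRinehartAlgebra ℝ (SmoothFun n M) (VecField n M) where
  smul_assoc c f X := by ext x; simp [mul_smul]
  smul_lie c X f := by ext x; simp [bracket_fun_apply]
  lie_smul c X f := by
    ext x
    have h : (⇑(c • f) : M → ℝ) = (fun _ : M => c) • ⇑f := rfl
    have := congrArg (fun T => T (X x)) (mvfderiv_smul (I := 𝓡 n)
      (mdifferentiableAt_const (c := c) (x := x)) (mdiffAt_fun f x))
    rw [bracket_fun_apply, h]
    simpa [bracket_fun_apply, mvfderiv_const] using this

end VecField

/-! ### Exterior forms and the de Rham complex -/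

section DeRham

variable (n : ℕ) (M : Type u) [TopologicalSpace M] [ChartedSpace (EuclideanSpace ℝ (Fin n)) M]
  [IsManifold (𝓡 n) ∞ M]

/-- Exterior `r`-forms on `M`, i.e. the `C^∞(M)`-multilinear alternating maps which take `r` vector
fields to a smooth function. -/
abbrev ExteriorForm (r : ℕ) : Type u := VecField n M [⋀^Fin r]→ₗ[SmoothFun n M] SmoothFun n M

/-- The de Rham complex of `M`. -/
def deRhamComplex : CochainComplex (ModuleCat.{u} ℝ) ℕ :=
  LieRinehart.ceComplex ℝ (SmoothFun n M) (VecField n M)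

end DeRham

/-- A regular foliation of rank `k` of an `n`-manifold `Z`, given by its tangent distribution: a
smooth involutive distribution of constant rank `k`. -/
structure Foliation (n k : ℕ) (Z : Type u) [TopologicalSpace Z]
    [ChartedSpace (EuclideanSpace ℝ (Fin n)) Z] [IsManifold (𝓡 n) ∞ Z] where
  /-- the fibre of the distribution at a point -/
  tangent : ∀ z : Z, Submodule ℝ (TangentSpace (𝓡 n) z)
  finrank_tangent : ∀ z, Module.finrank ℝ (tangent z) = k
  exists_local_frame : ∀ z₀ : Z, ∃ U : Set Z, IsOpen U ∧ z₀ ∈ U ∧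
    ∃ X : Fin k → ∀ z : Z, TangentSpace (𝓡 n) z,
      (∀ j, ContMDiffOn (𝓡 n) (𝓡 n).tangent ∞
        (fun z => (⟨z, X j z⟩ : TangentBundle (𝓡 n) Z)) U) ∧
      ∀ z ∈ U, tangent z = Submodule.span ℝ (Set.range fun j => X j z)
  involutive : ∀ X Y : VecField n Z, (∀ z, X z ∈ tangent z) → (∀ z, Y z ∈ tangent z) →
    ∀ z, mlieBracket (𝓡 n) X Y z ∈ tangent z

namespace Foliation

variable {n k : ℕ} {Z : Type u} [TopologicalSpace Z]
  [ChartedSpace (EuclideanSpace ℝ (Fin n)) Z] [IsManifold (𝓡 n) ∞ Z] (𝓕 : Foliation n k Z)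

/-- The Lie algebra and `C^∞(Z)`-module of global sections of the distribution. -/
def vecFields : LieRinehartSubalgebra (SmoothFun n Z) (VecField n Z) where
  carrier := {X | ∀ z, X z ∈ 𝓕.tangent z}
  add_mem' hX hY z := (𝓕.tangent z).add_mem (hX z) (hY z)
  zero_mem' z := (𝓕.tangent z).zero_mem
  smul_mem' f _ hX z := (𝓕.tangent z).smul_mem (f z) (hX z)
  lie_mem' {X Y} hX hY z := 𝓕.involutive X Y hX hY z

/-- The ring of smooth functions annihilated by all vector fields tangent to the foliation. -/
def basicFun : Subalgebra ℝ (SmoothFun n Z) where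
  carrier := {f | ∀ X ∈ 𝓕.vecFields, ⁅X, f⁆ = 0}
  mul_mem' {f g} hf hg X hX := by
    rw [LieRinehartRing.leibniz_mul_right, hf X hX, hg X hX, smul_zero, zero_mul, add_zero]
  add_mem' {f g} hf hg X hX := by rw [lie_add, hf X hX, hg X hX, add_zero]
  algebraMap_mem' c X _ := LieRinehart.lie_algebraMap ℝ X c

/-- Leafwise `r`-forms: `C^∞(Z)`-multilinear alternating maps which take `r` vector fields tangent
to the foliation to a smooth function. -/
abbrev LeafwiseForm (r : ℕ) : Type u :=
  𝓕.vecFields [⋀^Fin r]→ₗ[SmoothFun n Z] SmoothFun n Z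

/-- The leafwise de Rham complex. -/
def leafwiseComplex : CochainComplex (ModuleCat.{u} ℝ) ℕ :=
  LieRinehart.ceComplex ℝ (SmoothFun n Z) 𝓕.vecFields

/-- The cochain morphism from the de Rham complex to the leafwise de Rham complex that restricts an
exterior form to vector fields tangent to the foliation. -/
def restriction : deRhamComplex n Z ⟶ 𝓕.leafwiseComplex :=
  LieRinehart.restrictHom 𝓕.vecFields

/-- `j : N → Z` is an integral manifold of the distribution: an injective immersion whose
tangent spaces are the fibres of the distribution. -/
structure IsIntegralManifold {N : Type u} [TopologicalSpace N]
    [ChartedSpace (EuclideanSpace ℝ (Fin k)) N] (j : N → Z) : Prop where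
  contMDiff : ContMDiff (𝓡 k) (𝓡 n) ∞ j
  injective : Function.Injective j
  injective_mfderiv : ∀ p, Function.Injective (mfderiv (𝓡 k) (𝓡 n) j p)
  range_mfderiv : ∀ p, Set.range (mfderiv (𝓡 k) (𝓡 n) j p) = (𝓕.tangent (j p) : Set _)

/-- `i : F → Z` is a leaf: an integral manifold `F` (meant to be connected) which is maximal, i.e.
its image contains the image of each connected integral manifold that meets it. -/
structure IsLeaf {F : Type u} [TopologicalSpace F]
    [ChartedSpace (EuclideanSpace ℝ (Fin k)) F] (i : F → Z) : Prop
    extends 𝓕.IsIntegralManifold i where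
  maximal : ∀ (N : Type u) [TopologicalSpace N] [ChartedSpace (EuclideanSpace ℝ (Fin k)) N]
    [IsManifold (𝓡 k) ∞ N] [T2Space N] [SecondCountableTopology N] [ConnectedSpace N]
    (j : N → Z), 𝓕.IsIntegralManifold j → (Set.range j ∩ Set.range i).Nonempty →
      Set.range j ⊆ Set.range i

end Foliation

section Pullback

variable {n k : ℕ} {Z F : Type u}
  [TopologicalSpace Z] [ChartedSpace (EuclideanSpace ℝ (Fin n)) Z] [IsManifold (𝓡 n) ∞ Z]
  [TopologicalSpace F] [ChartedSpace (EuclideanSpace ℝ (Fin k)) F] [IsManifold (𝓡 k) ∞ F]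
  {r : ℕ}

/-- `η` is the pull-back of `θ` along `i`, i.e.
`η_p(Y₁, …, Y_r) = θ_{i(p)}(di Y₁, …, di Y_r)` at every point `p`. -/
def ExteriorForm.IsPullback (i : F → Z) (θ : ExteriorForm n Z r) (η : ExteriorForm k F r) : Prop :=
  ∀ (p : F) (X : Fin r → VecField n Z) (Y : Fin r → VecField k F),
    (∀ j, X j (i p) = mfderiv (𝓡 k) (𝓡 n) i p (Y j p)) → η Y p = θ X (i p)

/-- `η` is the pull-back of the leafwise form `φ` along `i`, i.e.
`η_p(Y₁, …, Y_r) = φ_{i(p)}(di Y₁, …, di Y_r)` at every point `p`. -/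
def Foliation.IsPullback (𝓕 : Foliation n k Z) (i : F → Z) (φ : 𝓕.LeafwiseForm r)
    (η : ExteriorForm k F r) : Prop :=
  ∀ (p : F) (X : Fin r → 𝓕.vecFields) (Y : Fin r → VecField k F),
    (∀ j, (X j : VecField n Z) (i p) = mfderiv (𝓡 k) (𝓡 n) i p (Y j p)) → η Y p = φ X (i p)

end Pullback

end

/-! Forms are multilinear maps on global vector fields, so pulling back is first a localization
problem. Near any point of `Z` there are functions `u m` and leafwise fields `e m` with `h • X = ∑
m, ⁅X, u m⁆ • e m` for every leafwise `X`, where `h` does not vanish at the point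
(`exists_adapted_frame`, `smul_eq_sum_of_frame`). Applying a form to this identity shows that its
value at a point depends only on the values of its arguments there (`Foliation.apply_congr`). Since
`di` maps into the distribution, `φ` can therefore be evaluated on pushed-forward vectors by
extending them to leafwise fields. Expanding all arguments in the frame shows that the result is
smooth on `F` (`contMDiff_pullbackFun`).

For the differential, pointwise extensions do not suffice, because the Koszul formula differentiates
its arguments. As `di` is a bijection onto the leafwise tangent space, a leafwise field lifts
smoothly to `F` near a given point (`exists_lift`). Brackets and derivatives of related fields are
related (`RelatedAt.lie`, `RelatedAt.lie_fun`), so the two Koszul formulas agree term by term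
(`pullbackForm_ceD`).

A function killed by leafwise fields has zero differential along `F`, hence is constant on the
connected `F`, and `ε` is evaluation at a point of the leaf. The factorization is built in: the
pull-back on `Z` is taken to be restriction followed by leafwise pull-back, and
`exteriorForm_isPullback_iff` identifies this composite with the usual pull-back. -/

noncomputable section

open scoped Topology

/-! ### Bump functions and cut-offs -/

section Localization

variable {n : ℕ} {M : Type*} [TopologicalSpace M] [ChartedSpace (EuclideanSpace ℝ (Fin n)) M]
  [IsManifold (𝓡 n) ∞ M] [T2Space M]

namespace SmoothFun

lemma exists_bump {x : M} {U : Set M} (hU : U ∈ 𝓝 x) :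
    ∃ χ : SmoothFun n M, tsupport χ ⊆ U ∧ ⇑χ =ᶠ[𝓝 x] 1 := by
  obtain ⟨f, -, hf⟩ := (SmoothBumpFunction.nhds_basis_tsupport (I := 𝓡 n) x).mem_iff.1 hU
  exact ⟨⟨f, f.contMDiff⟩, hf, f.eventuallyEq_one⟩

lemma exists_eventuallyEq {f : M → ℝ} {x : M} {U : Set M} (hU : IsOpen U) (hx : x ∈ U)
    (hf : ContMDiffOn (𝓡 n) 𝓘(ℝ, ℝ) ∞ f U) : ∃ g : SmoothFun n M, ⇑g =ᶠ[𝓝 x] f := by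
  obtain ⟨χ, hχ, h1⟩ := exists_bump (n := n) (hU.mem_nhds hx)
  refine ⟨⟨fun y => χ y * f y, contMDiff_of_tsupport fun y hy => ?_⟩, ?_⟩
  · have hyU : y ∈ U := hχ (tsupport_mul_subset_left hy)
    exact χ.contMDiff.contMDiffAt.mul (hf.contMDiffAt (hU.mem_nhds hyU))
  · filter_upwards [h1] with y hy
    change χ y * f y = f y
    simp [hy]

/-- Allows division by `h` near `x` while staying among global smooth functions; used to normalize
the frame in `exists_lift`. -/
lemma exists_eventually_mul_eq_one (h : SmoothFun n M) {x : M} (hx : h x ≠ 0) :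
    ∃ g : SmoothFun n M, ∀ᶠ y in 𝓝 x, g y * h y = 1 := by
  have hU : IsOpen {y | h y ≠ 0} := isOpen_ne.preimage h.contMDiff.continuous
  obtain ⟨g, hg⟩ := exists_eventuallyEq (n := n) (f := fun y => (h y)⁻¹) hU hx
    (fun y hy => (h.contMDiff.contMDiffAt.inv₀ hy).contMDiffWithinAt)
  refine ⟨g, ?_⟩
  filter_upwards [hg, hU.mem_nhds hx] with y h1 h2
  rw [h1]
  exact inv_mul_cancel₀ h2

/-- Every linear functional on a tangent space is the differential of a smooth function. -/
lemma exists_mvfderiv_eq (x : M) (ℓ : TangentSpace (𝓡 n) x →L[ℝ] ℝ) :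
    ∃ f : SmoothFun n M, ∀ v, mvfderiv (𝓡 n) f x v = ℓ v := by
  let ℓ' : EuclideanSpace ℝ (Fin n) →L[ℝ] ℝ := ℓ
  obtain ⟨f, hf⟩ := exists_eventuallyEq (n := n) (f := fun y => ℓ' (extChartAt (𝓡 n) x y))
    (isOpen_extChartAt_source (I := 𝓡 n) x) (mem_extChartAt_source (I := 𝓡 n) x)
    (by
      rw [extChartAt_source]
      exact ℓ'.contMDiff.comp_contMDiffOn (contMDiffOn_extChartAt (I := 𝓡 n) (x := x)))
  refine ⟨f, fun v => ?_⟩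
  have h1 : mfderiv (𝓡 n) 𝓘(ℝ, ℝ) f x = mfderiv (𝓡 n) 𝓘(ℝ, ℝ) (ℓ' ∘ extChartAt (𝓡 n) x) x :=
    hf.mfderiv_eq
  have h2 := mfderiv_comp x (I := 𝓡 n) (I' := 𝓘(ℝ, EuclideanSpace ℝ (Fin n))) (I'' := 𝓘(ℝ, ℝ))
    (g := ℓ') (f := extChartAt (𝓡 n) x)
    ℓ'.mdifferentiableAt (mdifferentiableAt_extChartAt (mem_chart_source _ x))
  -- The tangent space at `x` is identified with the model through the preferred chart at `x`, so
  -- the differential of that chart at `x` is the identity.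
  rw [mfderiv_extChartAt_self, mfderiv_eq_fderiv, ℓ'.fderiv] at h2
  have h3 := congrArg (fun T => T v) (h1.trans h2)
  exact h3

/-- A tangent vector which annihilates all smooth functions vanishes. -/
lemma eq_of_mvfderiv_eq {x : M} {v w : TangentSpace (𝓡 n) x}
    (h : ∀ f : SmoothFun n M, mvfderiv (𝓡 n) f x v = mvfderiv (𝓡 n) f x w) : v = w := by
  have : FiniteDimensional ℝ (TangentSpace (𝓡 n) x) :=
    inferInstanceAs (FiniteDimensional ℝ (EuclideanSpace ℝ (Fin n)))
  let v' : EuclideanSpace ℝ (Fin n) := v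
  let w' : EuclideanSpace ℝ (Fin n) := w
  have : v' = w' := by
    ext j
    obtain ⟨f, hf⟩ := exists_mvfderiv_eq (n := n) x (EuclideanSpace.proj (𝕜 := ℝ) j)
    have := h f
    rw [hf, hf] at this
    exact this
  exact this

end SmoothFun

namespace VecField

lemma exists_eq_bump_smul {X : Π x : M, TangentSpace (𝓡 n) x} {U : Set M} (hU : IsOpen U)
    (hX : ContMDiffOn (𝓡 n) (𝓡 n).tangent ∞ (fun x => (⟨x, X x⟩ : TangentBundle (𝓡 n) M)) U)
    (χ : SmoothFun n M) (hχ : tsupport χ ⊆ U) :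
    ∃ V : VecField n M, ∀ x, V x = χ x • X x := by
  refine ⟨⟨fun x => χ x • X x, fun x => ?_⟩, fun _ => rfl⟩
  by_cases hx : x ∈ tsupport χ
  · exact χ.contMDiff.contMDiffAt.smul_section (hX.contMDiffAt (hU.mem_nhds (hχ hx)))
  · refine ((0 : VecField n M).contMDiff x).congr_of_eventuallyEq ?_
    filter_upwards [(isClosed_tsupport χ).isOpen_compl.mem_nhds hx] with y hy
    have : χ y = 0 := image_eq_zero_of_notMem_tsupport hy
    simp [this]

end VecField

end Localization

/-! ### Adapted frames and the pointwise nature of leafwise forms -/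

namespace Foliation

variable {n k : ℕ} {Z : Type u} [TopologicalSpace Z]
  [ChartedSpace (EuclideanSpace ℝ (Fin n)) Z] [IsManifold (𝓡 n) ∞ Z] [T2Space Z]
  (𝓕 : Foliation n k Z)

lemma coe_smul (f : SmoothFun n Z) (X : 𝓕.vecFields) :
    ((f • X : 𝓕.vecFields) : VecField n Z) = f • (X : VecField n Z) := rfl

lemma coe_add (X Y : 𝓕.vecFields) :
    ((X + Y : 𝓕.vecFields) : VecField n Z) = X + Y := rfl

lemma coe_sum {ι : Type*} (s : Finset ι) (X : ι → 𝓕.vecFields) (z : Z) :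
    ((∑ j ∈ s, X j : 𝓕.vecFields) : VecField n Z) z = ∑ j ∈ s, (X j : VecField n Z) z := by
  induction s using Finset.cons_induction with
  | empty => rfl
  | cons a s ha ih => rw [Finset.sum_cons, Finset.sum_cons, coe_add, VecField.add_apply, ih]

/-- A local frame of the distribution, cut off to global vector fields. -/
lemma exists_global_frame (z₀ : Z) :
    ∃ (χ : SmoothFun n Z) (V : Fin k → 𝓕.vecFields), χ z₀ = 1 ∧
      LinearIndependent ℝ (fun l => (V l : VecField n Z) z₀) ∧
      ∀ z, χ z ≠ 0 → ∀ v ∈ 𝓕.tangent z, ∃ c : Fin k → ℝ, v = ∑ l, c l • (V l : VecField n Z) z := by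
  obtain ⟨U, hU, hz₀, X, hX, hspan⟩ := 𝓕.exists_local_frame z₀
  obtain ⟨χ, hχ, h1⟩ := SmoothFun.exists_bump (n := n) (hU.mem_nhds hz₀)
  have h1 : χ z₀ = 1 := h1.self_of_nhds
  have hχU : ∀ z, χ z ≠ 0 → z ∈ U := fun z hz => hχ (subset_tsupport _ hz)
  choose V hV using fun l => VecField.exists_eq_bump_smul hU (hX l) χ hχ
  have hmem : ∀ l, V l ∈ 𝓕.vecFields := by
    intro l z
    rw [hV]
    by_cases hz : χ z = 0
    · rw [hz, zero_smul]; exact (𝓕.tangent z).zero_mem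
    · refine (𝓕.tangent z).smul_mem _ ?_
      rw [hspan z (hχU z hz)]
      exact Submodule.subset_span ⟨l, rfl⟩
  refine ⟨χ, fun l => ⟨V l, hmem l⟩, h1, ?_, ?_⟩
  · have : (fun l => V l z₀) = fun l => X l z₀ := by
      funext l; rw [hV, h1, one_smul]
    change LinearIndependent ℝ (fun l => V l z₀)
    -- A spanning family of `k` vectors in a space of dimension `k` is independent.
    rw [this, linearIndependent_iff_card_eq_finrank_span, Fintype.card_fin, Set.finrank,
      ← hspan z₀ hz₀, 𝓕.finrank_tangent]
  · intro z hz v hv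
    rw [hspan z (hχU z hz)] at hv
    obtain ⟨c, hc⟩ := (Submodule.mem_span_range_iff_exists_fun ℝ).1 hv
    refine ⟨fun l => c l * (χ z)⁻¹, ?_⟩
    rw [← hc]
    refine Finset.sum_congr rfl fun l _ => ?_
    change c l • X l z = (c l * (χ z)⁻¹) • V l z
    rw [hV, smul_smul, mul_assoc, inv_mul_cancel₀ hz, mul_one]

/-- Functions which restrict to coordinates on a leafwise tangent space near `z₀` give rise to a
dual family of leafwise vector fields. -/
lemma exists_dual_frame (z₀ : Z) (u : Fin k → SmoothFun n Z)
    (hu : ∀ v ∈ 𝓕.tangent z₀, (∀ m, mvfderiv (𝓡 n) (u m) z₀ v = 0) → v = 0) :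
    ∃ (h : SmoothFun n Z) (e : Fin k → 𝓕.vecFields), h z₀ ≠ 0 ∧
      (∀ z, ∀ v ∈ 𝓕.tangent z,
        h z • v = ∑ m, mvfderiv (𝓡 n) (u m) z v • (e m : VecField n Z) z) ∧
      ∀ l m, ⁅(e l : VecField n Z), u m⁆ = if l = m then h else 0 := by
  obtain ⟨χ, V, h1, hlin, hV⟩ := 𝓕.exists_global_frame z₀
  -- The dual frame is obtained by inverting this matrix of derivatives. The adjugate replaces the
  -- inverse, so that everything remains a global smooth function.
  let A : Matrix (Fin k) (Fin k) (SmoothFun n Z) := fun m l => ⁅(V l : VecField n Z), u m⁆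
  let ev : ∀ z : Z, SmoothFun n Z →+* ℝ := fun z => ContMDiffMap.evalRingHom z
  have hev : ∀ z f, ev z f = f z := fun _ _ => rfl
  have hdu : ∀ z (c : Fin k → ℝ) m,
      mvfderiv (𝓡 n) (u m) z (∑ l, c l • (V l : VecField n Z) z) =
        ((A.map (ev z)).mulVec c) m := by
    intro z c m
    rw [map_sum]
    refine Finset.sum_congr rfl fun l _ => ?_
    rw [map_smul, smul_eq_mul, mul_comm]
    rfl
  -- A kernel vector of `A` at `z₀` would give a leafwise vector annihilated by all `u m`.
  have hdet : A.det z₀ ≠ 0 := by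
    rw [← hev, RingHom.map_det]
    intro h0
    obtain ⟨c, hc0, hc⟩ := Matrix.exists_mulVec_eq_zero_iff.2 h0
    refine hc0 (funext fun l => ?_)
    refine Fintype.linearIndependent_iff.1 hlin c (hu _ ?_ fun m => ?_) l
    · exact Submodule.sum_mem _ fun l _ => Submodule.smul_mem _ _ ((V l).2 z₀)
    · rw [hdu]; exact congrFun hc m
  -- The `V l` are known to span only where `χ ≠ 0`. The extra factor `χ` makes both sides of the
  -- expansion vanish elsewhere, so that it holds on all of `Z`.
  refine ⟨χ * A.det, fun m => χ • ∑ l, A.adjugate l m • V l, ?_, ?_, ?_⟩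
  · change χ z₀ * A.det z₀ ≠ 0
    rw [h1, one_mul]; exact hdet
  · intro z v hv
    simp only [coe_smul, VecField.smul_apply, coe_sum]
    change (χ z * A.det z) • v = _
    by_cases hz : χ z = 0
    · simp [hz]
    obtain ⟨c, rfl⟩ := hV z hz v hv
    simp only [hdu]
    have key : ∀ l, A.det z * c l = ∑ m, A.adjugate l m z * ((A.map (ev z)).mulVec c) m := by
      intro l
      have := congrFun (congrArg (fun B => (B : Matrix _ _ ℝ).mulVec c)
        (Matrix.adjugate_mul (A.map (ev z)))) l
      simp only [← Matrix.mulVec_mulVec, Matrix.smul_mulVec, Matrix.one_mulVec] at this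
      rw [show (A.map (ev z)).det = A.det z from ((ev z).map_det A).symm,
        show (A.map (ev z)).adjugate = A.adjugate.map (ev z) from
          ((ev z).map_adjugate A).symm] at this
      exact this.symm
    simp only [Finset.smul_sum, smul_smul]
    rw [Finset.sum_comm]
    refine Finset.sum_congr rfl fun l _ => ?_
    rw [← Finset.sum_smul, mul_assoc, key, Finset.mul_sum]
    congr 1
    exact Finset.sum_congr rfl fun m _ => by ring
  · intro m p
    have h2 : ∀ W : 𝓕.vecFields, ⁅(W : VecField n Z), u p⁆ = ⁅W, u p⁆ := fun _ => rfl
    have h3 : ⁅(∑ l, A.adjugate l m • V l : 𝓕.vecFields), u p⁆ = (A * A.adjugate) p m := by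
      rw [sum_lie, Matrix.mul_apply]
      refine Finset.sum_congr rfl fun l _ => ?_
      rw [LieRinehartRing.lie_smul_eq_mul, mul_comm]
      rfl
    rw [h2, LieRinehartRing.lie_smul_eq_mul, h3, Matrix.mul_adjugate, Matrix.smul_apply,
      Matrix.one_apply, smul_eq_mul]
    simp only [eq_comm (a := p), mul_ite, mul_one, mul_zero]

/-- The `u m` are chosen so that their differentials at `z₀` restrict to the dual basis of a basis
of the leafwise tangent space; `exists_dual_frame` does the rest. -/
lemma exists_adapted_frame (z₀ : Z) :
    ∃ (u : Fin k → SmoothFun n Z) (h : SmoothFun n Z) (e : Fin k → 𝓕.vecFields), h z₀ ≠ 0 ∧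
      ∀ z, ∀ v ∈ 𝓕.tangent z,
        h z • v = ∑ m, mvfderiv (𝓡 n) (u m) z v • (e m : VecField n Z) z := by
  have : FiniteDimensional ℝ (TangentSpace (𝓡 n) z₀) :=
    inferInstanceAs (FiniteDimensional ℝ (EuclideanSpace ℝ (Fin n)))
  have : T2Space (TangentSpace (𝓡 n) z₀) := inferInstanceAs (T2Space (EuclideanSpace ℝ (Fin n)))
  let b := Module.finBasisOfFinrankEq ℝ (𝓕.tangent z₀) (𝓕.finrank_tangent z₀)
  choose ℓ hℓ using fun m => LinearMap.exists_extend (b.coord m)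
  choose u hu using fun m =>
    SmoothFun.exists_mvfderiv_eq (n := n) z₀ (LinearMap.toContinuousLinearMap (ℓ m))
  obtain ⟨h, e, h0, he, -⟩ := 𝓕.exists_dual_frame z₀ u (by
    intro v hv h
    have : (⟨v, hv⟩ : 𝓕.tangent z₀) = 0 := by
      refine b.ext_elem fun m => ?_
      rw [← b.coord_apply, ← hℓ m, map_zero, Finsupp.zero_apply]
      have := h m
      rw [hu] at this
      exact this
    exact congrArg Subtype.val this)
  exact ⟨u, h, e, h0, he⟩

/-- Turns the pointwise expansion into one over the ring of smooth functions, to which a multilinear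
form can be applied. -/
lemma smul_eq_sum_of_frame {u : Fin k → SmoothFun n Z} {h : SmoothFun n Z}
    {e : Fin k → 𝓕.vecFields}
    (he : ∀ z, ∀ v ∈ 𝓕.tangent z,
        h z • v = ∑ m, mvfderiv (𝓡 n) (u m) z v • (e m : VecField n Z) z)
    (X : 𝓕.vecFields) : h • X = ∑ m, ⁅X, u m⁆ • e m := by
  apply Subtype.ext
  ext z : 1
  rw [coe_smul, VecField.smul_apply, coe_sum, he z _ (X.2 z)]
  rfl

/-- Every vector tangent to the foliation extends to a leafwise vector field. -/
lemma exists_vecField_eq (z : Z) (v : TangentSpace (𝓡 n) z) (hv : v ∈ 𝓕.tangent z) :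
    ∃ X : 𝓕.vecFields, (X : VecField n Z) z = v := by
  obtain ⟨u, h, e, h0, he⟩ := 𝓕.exists_adapted_frame z
  let c : Fin k → SmoothFun n Z := fun m =>
    algebraMap ℝ _ ((h z)⁻¹ * mvfderiv (𝓡 n) (u m) z v)
  refine ⟨∑ m, c m • e m, ?_⟩
  rw [coe_sum]
  have : ∀ m, ((c m • e m : 𝓕.vecFields) : VecField n Z) z =
      (h z)⁻¹ • (mvfderiv (𝓡 n) (u m) z v • (e m : VecField n Z) z) := by
    intro m
    rw [smul_smul]
    rfl
  simp only [this]
  rw [← Finset.smul_sum, ← he z v hv, smul_smul, inv_mul_cancel₀ h0, one_smul]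

variable {r : ℕ}

/-- The value of a leafwise form at a point depends only on the values of the vector fields. -/
lemma apply_update_eq_zero (φ : 𝓕.LeafwiseForm r) (X : Fin r → 𝓕.vecFields) (j : Fin r)
    (Y : 𝓕.vecFields) {z : Z} (hY : (Y : VecField n Z) z = 0) :
    φ (Function.update X j Y) z = 0 := by
  obtain ⟨u, h, e, h0, he⟩ := 𝓕.exists_adapted_frame z
  have h1 := φ.map_update_smul X j h Y
  -- The coefficients `⁅Y, u m⁆` vanish at `z` because `Y` does, while `h z ≠ 0` can be cancelled.
  rw [𝓕.smul_eq_sum_of_frame he, φ.map_update_sum] at h1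
  simp only [φ.map_update_smul] at h1
  let ev : SmoothFun n Z →+* ℝ := ContMDiffMap.evalRingHom z
  have h2 := congrArg ev h1
  rw [map_sum, Finset.sum_eq_zero] at h2
  · exact (mul_eq_zero.1 h2.symm).resolve_left h0
  · intro m _
    have : ⁅Y, u m⁆ z = 0 := by
      change mvfderiv (𝓡 n) (u m) z ((Y : VecField n Z) z) = 0
      rw [hY, map_zero]
    change ⁅Y, u m⁆ z * _ = 0
    rw [this, zero_mul]

lemma apply_congr (φ : 𝓕.LeafwiseForm r) (X Y : Fin r → 𝓕.vecFields) {z : Z}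
    (h : ∀ j, (X j : VecField n Z) z = (Y j : VecField n Z) z) : φ X z = φ Y z := by
  -- The arguments are exchanged one at a time, each contributing a difference that vanishes at `z`.
  have key : ∀ s : Finset (Fin r), φ (s.piecewise X Y) z = φ Y z := by
    intro s
    induction s using Finset.cons_induction with
    | empty => rw [Finset.piecewise_empty]
    | cons a s ha ih =>
      rw [← ih, Finset.cons_eq_insert, Finset.piecewise_insert]
      have h1 : X a = Y a + (X a - Y a) := by abel
      have h2 : ((X a - Y a : 𝓕.vecFields) : VecField n Z) z = 0 := by
        change (X a : VecField n Z) z - (Y a : VecField n Z) z = 0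
        rw [h, sub_self]
      have h3 : Function.update (s.piecewise X Y) a (Y a) = s.piecewise X Y := by
        rw [Function.update_eq_self_iff, Finset.piecewise_eq_of_notMem _ _ _ ha]
      rw [h1, φ.map_update_add, h3]
      change φ _ z + φ _ z = _
      rw [𝓕.apply_update_eq_zero φ _ a _ h2, add_zero]
  rw [← key Finset.univ, Finset.piecewise_univ]

/-- The foliation with one leaf on each connected component. -/
def whole (n : ℕ) (Z : Type u) [TopologicalSpace Z]
    [ChartedSpace (EuclideanSpace ℝ (Fin n)) Z] [IsManifold (𝓡 n) ∞ Z] : Foliation n n Z where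
  tangent _ := ⊤
  finrank_tangent z := by
    rw [finrank_top]
    exact finrank_euclideanSpace_fin (𝕜 := ℝ) (n := n)
  exists_local_frame z₀ := by
    let t := trivializationAt (EuclideanSpace ℝ (Fin n)) (TangentSpace (𝓡 n) : Z → Type) z₀
    let b := (EuclideanSpace.basisFun (Fin n) ℝ).toBasis
    have H := t.isLocalFrameOn_localFrame_baseSet (𝓡 n) ∞ b
    refine ⟨t.baseSet, t.open_baseSet, FiberBundle.mem_baseSet_trivializationAt' z₀,
      t.localFrame b, H.contMDiffOn, fun z hz => ?_⟩
    exact (top_le_iff.1 (H.generating hz)).symm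
  involutive _ _ _ _ _ := Submodule.mem_top

end Foliation

namespace VecField

variable {n : ℕ} {M : Type u} [TopologicalSpace M] [ChartedSpace (EuclideanSpace ℝ (Fin n)) M]
  [IsManifold (𝓡 n) ∞ M]

/-- A vector field as a leafwise vector field of the foliation by connected components. -/
def toWhole (X : VecField n M) : (Foliation.whole n M).vecFields := ⟨X, fun _ => Submodule.mem_top⟩

end VecField

namespace ExteriorForm

variable {n r : ℕ} {M : Type u} [TopologicalSpace M] [ChartedSpace (EuclideanSpace ℝ (Fin n)) M]
  [IsManifold (𝓡 n) ∞ M] [T2Space M]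

/-- Exterior forms are leafwise forms of the foliation `whole`, whose leafwise fields are all vector
fields. -/
lemma apply_congr (θ : ExteriorForm n M r) (X Y : Fin r → VecField n M) {x : M}
    (h : ∀ j, X j x = Y j x) : θ X x = θ Y x :=
  (Foliation.whole n M).apply_congr
    (θ.compLinearMap (LieRinehart.inclLinear (Foliation.whole n M).vecFields))
    (fun j => (X j).toWhole) (fun j => (Y j).toWhole) h

end ExteriorForm

/-! ### Pull-back of functions and related vector fields -/

namespace SmoothFun

variable {n k : ℕ} {Z F : Type u}
  [TopologicalSpace Z] [ChartedSpace (EuclideanSpace ℝ (Fin n)) Z] [IsManifold (𝓡 n) ∞ Z]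
  [TopologicalSpace F] [ChartedSpace (EuclideanSpace ℝ (Fin k)) F] [IsManifold (𝓡 k) ∞ F]

/-- Composition of smooth functions with a smooth map. -/
def pullback {i : F → Z} (hi : ContMDiff (𝓡 k) (𝓡 n) ∞ i) (f : SmoothFun n Z) : SmoothFun k F :=
  f.comp ⟨i, hi⟩

variable {i : F → Z} (hi : ContMDiff (𝓡 k) (𝓡 n) ∞ i)

lemma mvfderiv_pullback (f : SmoothFun n Z) (p : F) (v : TangentSpace (𝓡 k) p) :
    mvfderiv (𝓡 k) (pullback hi f) p v =
      mvfderiv (𝓡 n) f (i p) (mfderiv (𝓡 k) (𝓡 n) i p v) := by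
  have := mfderiv_comp p (I := 𝓡 k) (I' := 𝓡 n) (I'' := 𝓘(ℝ, ℝ)) (g := f) (f := i)
    (VecField.mdiffAt_fun f (i p)) (hi.mdifferentiable (by simp) p)
  exact congrArg (fun T => T v) this

lemma mvfderiv_congr {f g : F → ℝ} {p : F} (h : f =ᶠ[𝓝 p] g) (v : TangentSpace (𝓡 k) p) :
    mvfderiv (𝓡 k) f p v = mvfderiv (𝓡 k) g p v :=
  congrArg (fun T => T v) (h.mfderiv_eq (I := 𝓡 k) (I' := 𝓘(ℝ, ℝ)))

end SmoothFun

namespace VecField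

variable {n k : ℕ} {Z F : Type u}
  [TopologicalSpace Z] [ChartedSpace (EuclideanSpace ℝ (Fin n)) Z] [IsManifold (𝓡 n) ∞ Z]
  [TopologicalSpace F] [ChartedSpace (EuclideanSpace ℝ (Fin k)) F] [IsManifold (𝓡 k) ∞ F]

/-- `X` and `Y` are related by `i` at the point `p`. -/
def RelatedAt (i : F → Z) (X : VecField n Z) (Y : VecField k F) (p : F) : Prop :=
  X (i p) = mfderiv (𝓡 k) (𝓡 n) i p (Y p)

variable {i : F → Z} (hi : ContMDiff (𝓡 k) (𝓡 n) ∞ i)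

lemma RelatedAt.lie_fun {X : VecField n Z} {Y : VecField k F} {p : F} (h : RelatedAt i X Y p)
    (f : SmoothFun n Z) : ⁅Y, SmoothFun.pullback hi f⁆ p = ⁅X, f⁆ (i p) := by
  rw [bracket_fun_apply, bracket_fun_apply, SmoothFun.mvfderiv_pullback, h]

-- Tangent vectors are determined by their action on functions, and `[Y, Y']` acts as a commutator.
-- The inner derivative must be related on a neighbourhood, since it is differentiated again; this
-- is why the hypotheses are local and not just at `p`.
include hi in
lemma RelatedAt.lie [T2Space Z] {X X' : VecField n Z} {Y Y' : VecField k F} {p : F}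
    (h : ∀ᶠ q in 𝓝 p, RelatedAt i X Y q) (h' : ∀ᶠ q in 𝓝 p, RelatedAt i X' Y' q) :
    RelatedAt i ⁅X, X'⁆ ⁅Y, Y'⁆ p := by
  refine SmoothFun.eq_of_mvfderiv_eq fun f => ?_
  have key : ∀ (V V' : VecField n Z) (W W' : VecField k F), RelatedAt i V W p →
      (∀ᶠ q in 𝓝 p, RelatedAt i V' W' q) →
      ⁅W, ⁅W', SmoothFun.pullback hi f⁆⁆ p = ⁅V, ⁅V', f⁆⁆ (i p) := by
    intro V V' W W' hVW hVW'
    rw [← hVW.lie_fun hi, bracket_fun_apply, bracket_fun_apply]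
    refine SmoothFun.mvfderiv_congr ?_ _
    filter_upwards [hVW'] with q hq
    exact hq.lie_fun hi f
  rw [← SmoothFun.mvfderiv_pullback hi, ← bracket_fun_apply, ← bracket_fun_apply, lie_lie_fun,
    lie_lie_fun]
  rw [ContMDiffMap.coe_sub, ContMDiffMap.coe_sub, Pi.sub_apply, Pi.sub_apply]
  rw [key X X' Y Y' h.self_of_nhds h', key X' X Y' Y h'.self_of_nhds h]

end VecField

/-! ### Lifting to integral manifolds and smoothness of pull-backs -/

namespace Foliation

variable {n k r : ℕ} {Z F : Type u}
  [TopologicalSpace Z] [ChartedSpace (EuclideanSpace ℝ (Fin n)) Z] [IsManifold (𝓡 n) ∞ Z]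
  [T2Space Z]
  [TopologicalSpace F] [ChartedSpace (EuclideanSpace ℝ (Fin k)) F] [IsManifold (𝓡 k) ∞ F]
  {𝓕 : Foliation n k Z} {i : F → Z}

/-- Evaluate `φ` on the fields `h • X j` in two ways: pull out one factor `h` per slot, or expand
every slot in the frame. -/
lemma pow_mul_apply_of_frame (𝓕 : Foliation n k Z) {u : Fin k → SmoothFun n Z}
    {h : SmoothFun n Z} {e : Fin k → 𝓕.vecFields}
    (he : ∀ z, ∀ v ∈ 𝓕.tangent z,
        h z • v = ∑ m, mvfderiv (𝓡 n) (u m) z v • (e m : VecField n Z) z)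
    (φ : 𝓕.LeafwiseForm r) (X : Fin r → 𝓕.vecFields) :
    h ^ r * φ X = ∑ m : Fin r → Fin k, (∏ j, ⁅X j, u (m j)⁆) * φ fun j => e (m j) := by
  have h1 := φ.toMultilinearMap.map_smul_univ (fun _ => h) X
  simp only [𝓕.smul_eq_sum_of_frame he] at h1
  rw [φ.toMultilinearMap.map_sum (fun j m => ⁅X j, u m⁆ • e m), Finset.prod_const,
    Finset.card_univ, Fintype.card_fin] at h1
  refine h1.symm.trans (Finset.sum_congr rfl fun m _ => ?_)
  exact φ.toMultilinearMap.map_smul_univ (fun j => ⁅X j, u (m j)⁆) fun j => e (m j)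

namespace IsIntegralManifold

variable (hi : 𝓕.IsIntegralManifold i)
include hi

lemma mfderiv_mem (p : F) (v : TangentSpace (𝓡 k) p) :
    mfderiv (𝓡 k) (𝓡 n) i p v ∈ 𝓕.tangent (i p) := by
  rw [← SetLike.mem_coe, ← hi.range_mfderiv]
  exact ⟨v, rfl⟩

lemma exists_mfderiv_eq {p : F} {v : TangentSpace (𝓡 n) (i p)} (hv : v ∈ 𝓕.tangent (i p)) :
    ∃ w, mfderiv (𝓡 k) (𝓡 n) i p w = v := by
  rw [← SetLike.mem_coe, ← hi.range_mfderiv] at hv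
  exact hv

lemma exists_relatedAt (Y : VecField k F) (p : F) :
    ∃ X : 𝓕.vecFields, VecField.RelatedAt i (X : VecField n Z) Y p :=
  𝓕.exists_vecField_eq (i p) _ (hi.mfderiv_mem p (Y p))

/-- Leafwise vector fields lift locally to an integral manifold. -/
lemma exists_lift [T2Space F] (X : 𝓕.vecFields) (p₀ : F) :
    ∃ Y : VecField k F, ∀ᶠ p in 𝓝 p₀, VecField.RelatedAt i (X : VecField n Z) Y p := by
  obtain ⟨u, h, e, h0, he⟩ := 𝓕.exists_adapted_frame (i p₀)
  -- The functions `u m ∘ i` are local coordinates on `F` at the infinitesimal level: if they all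
  -- kill `v`, the frame expansion kills `di v`, and `i` is an immersion.
  have hinj : ∀ p, h (i p) ≠ 0 → ∀ v : TangentSpace (𝓡 k) p,
      (∀ m, mvfderiv (𝓡 k) (SmoothFun.pullback hi.contMDiff (u m)) p v = 0) → v = 0 := by
    intro p hp v hv
    have := he (i p) _ (hi.mfderiv_mem p v)
    simp only [← SmoothFun.mvfderiv_pullback hi.contMDiff, hv, zero_smul,
      Finset.sum_const_zero] at this
    exact hi.injective_mfderiv p (((smul_eq_zero.1 this).resolve_left hp).trans (map_zero _).symm)
  obtain ⟨d, b, hd0, -, hb⟩ := (whole k F).exists_dual_frame p₀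
    (fun m => SmoothFun.pullback hi.contMDiff (u m)) (fun v _ hv => hinj p₀ h0 v hv)
  obtain ⟨g, hg⟩ := SmoothFun.exists_eventually_mul_eq_one d hd0
  -- Since `b l` applied to `u m ∘ i` is `d` if `l = m` and zero otherwise, and `g * d = 1` near
  -- `p₀`, this field differentiates each `u m ∘ i` there to `⁅X, u m⁆ ∘ i`.
  refine ⟨g • ((∑ m, SmoothFun.pullback hi.contMDiff ⁅X, u m⁆ • b m :
    (whole k F).vecFields) : VecField k F), ?_⟩
  have hev : ∀ᶠ p in 𝓝 p₀, h (i p) ≠ 0 :=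
    (SmoothFun.pullback hi.contMDiff h).contMDiff.continuous.continuousAt.eventually_ne h0
  filter_upwards [hg, hev] with p hgp hhp
  obtain ⟨w, hw⟩ := hi.exists_mfderiv_eq (X.2 (i p))
  have hW : ∀ m, mvfderiv (𝓡 k) (SmoothFun.pullback hi.contMDiff (u m)) p
      (((∑ m, SmoothFun.pullback hi.contMDiff ⁅X, u m⁆ • b m :
        (whole k F).vecFields) : VecField k F) p) =
      d p * mvfderiv (𝓡 n) (u m) (i p) ((X : VecField n Z) (i p)) := by
    intro m
    rw [coe_sum, map_sum, Finset.sum_eq_single m]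
    · rw [coe_smul, VecField.smul_apply, map_smul, ← VecField.bracket_fun_apply, hb, if_pos rfl,
        smul_eq_mul, mul_comm]
      rfl
    · intro l _ hl
      rw [coe_smul, VecField.smul_apply, map_smul, ← VecField.bracket_fun_apply, hb, if_neg hl]
      exact smul_zero _
    · intro hm; exact absurd (Finset.mem_univ m) hm
  -- The pointwise preimage `w` of `X` and the smooth candidate have the same derivatives of all `u
  -- m ∘ i`, so they coincide by `hinj`.
  rw [VecField.RelatedAt, ← hw]
  congr 1
  refine sub_eq_zero.1 (hinj p hhp _ fun m => ?_)
  rw [map_sub, VecField.smul_apply, map_smul, hW, SmoothFun.mvfderiv_pullback, hw, smul_eq_mul,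
    ← mul_assoc, hgp, one_mul, sub_self]

/-- The value of the pull-back of a leafwise form on vector fields, as a function. -/
def pullbackFun (φ : 𝓕.LeafwiseForm r) (Y : Fin r → VecField k F) (p : F) : ℝ :=
  φ (fun j => (hi.exists_relatedAt (Y j) p).choose) (i p)

/-- Independence of the chosen extensions, from `apply_congr`. -/
lemma pullbackFun_eq (φ : 𝓕.LeafwiseForm r) {Y : Fin r → VecField k F} {p : F}
    {X : Fin r → 𝓕.vecFields} (h : ∀ j, VecField.RelatedAt i (X j : VecField n Z) (Y j) p) :
    hi.pullbackFun φ Y p = φ X (i p) :=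
  𝓕.apply_congr φ _ _ fun j => (hi.exists_relatedAt (Y j) p).choose_spec.trans (h j).symm

lemma contMDiff_pullbackFun (φ : 𝓕.LeafwiseForm r) (Y : Fin r → VecField k F) :
    ContMDiff (𝓡 k) 𝓘(ℝ, ℝ) ∞ (hi.pullbackFun φ Y) := by
  intro p₀
  obtain ⟨u, h, e, h0, he⟩ := 𝓕.exists_adapted_frame (i p₀)
  let H : SmoothFun k F := SmoothFun.pullback hi.contMDiff h ^ r
  let G : SmoothFun k F := ∑ m : Fin r → Fin k,
    (∏ j, ⁅Y j, SmoothFun.pullback hi.contMDiff (u (m j))⁆) *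
      SmoothFun.pullback hi.contMDiff (φ fun j => e (m j))
  -- The extensions `X` vary with `p` without any regularity, but in the frame expansion they enter
  -- only through `⁅X j, u m⁆` at `i p`, which is the derivative of `u m ∘ i` along `Y j` and hence
  -- smooth in `p`.
  have key : ∀ p, H p * hi.pullbackFun φ Y p = G p := by
    intro p
    choose X hX using fun j => hi.exists_relatedAt (Y j) p
    rw [hi.pullbackFun_eq φ hX]
    have h1 := congrArg (ContMDiffMap.evalRingHom (I := 𝓡 n) (n := ∞) (R := ℝ) (i p))
      (𝓕.pow_mul_apply_of_frame he φ X)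
    rw [map_mul, map_pow, map_sum] at h1
    have h2 : G p = ContMDiffMap.evalRingHom (I := 𝓡 k) (n := ∞) (R := ℝ) p G := rfl
    have h3 : H p = ContMDiffMap.evalRingHom (I := 𝓡 k) (n := ∞) (R := ℝ) p H := rfl
    rw [h2, h3, map_sum, map_pow]
    refine h1.trans (Finset.sum_congr rfl fun m _ => ?_)
    rw [map_mul, map_mul, map_prod, map_prod]
    congr 1
    exact Finset.prod_congr rfl fun j _ => ((hX j).lie_fun hi.contMDiff (u (m j))).symm
  have hH : H p₀ ≠ 0 := by
    have : H p₀ = h (i p₀) ^ r :=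
      map_pow (ContMDiffMap.evalRingHom (I := 𝓡 k) (n := ∞) (R := ℝ) p₀)
        (SmoothFun.pullback hi.contMDiff h) r
    rw [this]
    exact pow_ne_zero r h0
  have hev : ∀ᶠ p in 𝓝 p₀, H p ≠ 0 :=
    H.contMDiff.continuous.continuousAt.eventually_ne hH
  refine ((H.contMDiff.contMDiffAt.inv₀ hH).mul (G.contMDiff p₀)).congr_of_eventuallyEq ?_
  filter_upwards [hev] with p hp
  exact (inv_mul_eq_iff_eq_mul₀ hp).2 (key p).symm |>.symm

end IsIntegralManifold
end Foliation

/-! ### Functions with zero differential -/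

section Constancy

variable {k : ℕ} {F : Type u} [TopologicalSpace F] [ChartedSpace (EuclideanSpace ℝ (Fin k)) F]
  [IsManifold (𝓡 k) ∞ F]

/-- In a chart the derivative vanishes on a convex ball, so `f` is locally constant; connectedness
finishes. -/
lemma SmoothFun.eq_of_mvfderiv_eq_zero [ConnectedSpace F] (f : SmoothFun k F)
    (hf : ∀ p v, mvfderiv (𝓡 k) f p v = 0) (p q : F) : f p = f q := by
  refine IsLocallyConstant.apply_eq_of_preconnectedSpace ?_ p q
  rw [IsLocallyConstant.iff_eventually_eq]
  intro p
  let c := extChartAt (𝓡 k) p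
  let g : EuclideanSpace ℝ (Fin k) → ℝ := f ∘ c.symm
  have ht : IsOpen c.target := isOpen_extChartAt_target p
  obtain ⟨ε, hε, hball⟩ := Metric.isOpen_iff.1 ht (c p) (mem_extChartAt_target p)
  have hmd : ∀ x ∈ c.target, MDifferentiableAt 𝓘(ℝ, EuclideanSpace ℝ (Fin k)) (𝓡 k) c.symm x :=
    fun x hx => ((contMDiffOn_extChartAt_symm (I := 𝓡 k) (n := ∞) p).contMDiffAt
      (ht.mem_nhds hx)).mdifferentiableAt (by simp)
  have hg : ∀ x ∈ c.target, HasFDerivAt g (0 : EuclideanSpace ℝ (Fin k) →L[ℝ] ℝ) x := by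
    intro x hx
    have h1 := (VecField.mdiffAt_fun f (c.symm x)).hasMFDerivAt.comp x (hmd x hx).hasMFDerivAt
    have h2 : mfderiv (𝓡 k) 𝓘(ℝ, ℝ) f (c.symm x) = 0 := by
      ext v
      exact hf _ v
    rw [h2, ContinuousLinearMap.zero_comp] at h1
    exact hasMFDerivAt_iff_hasFDerivAt.1 h1
  have hev : ∀ᶠ y in 𝓝 p, y ∈ c.source ∧ c y ∈ Metric.ball (c p) ε :=
    Filter.Eventually.and (extChartAt_source_mem_nhds (I := 𝓡 k) p)
      ((continuousAt_extChartAt (I := 𝓡 k) p).eventually (Metric.ball_mem_nhds _ hε))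
  filter_upwards [hev] with y hy
  have := (convex_ball (c p) ε).is_const_of_fderivWithin_eq_zero (𝕜 := ℝ) (f := g)
    (fun x hx => (hg x (hball hx)).differentiableAt.differentiableWithinAt)
    (fun x hx => by
      rw [fderivWithin_of_isOpen Metric.isOpen_ball hx, (hg x (hball hx)).fderiv])
    hy.2 (Metric.mem_ball_self hε)
  change f (c.symm (c y)) = f (c.symm (c p)) at this
  rwa [c.left_inv hy.1, c.left_inv (mem_extChartAt_source p)] at this

end Constancy

/-! ### The pull-back cochain morphism -/

namespace Foliation

variable {n k r : ℕ} {Z F : Type u}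
  [TopologicalSpace Z] [ChartedSpace (EuclideanSpace ℝ (Fin n)) Z] [IsManifold (𝓡 n) ∞ Z]
  [T2Space Z]
  [TopologicalSpace F] [ChartedSpace (EuclideanSpace ℝ (Fin k)) F] [IsManifold (𝓡 k) ∞ F]
  {𝓕 : Foliation n k Z} {i : F → Z}

namespace IsIntegralManifold

variable (hi : 𝓕.IsIntegralManifold i)

open Function

/-- The pull-back of a leafwise form to an integral manifold. -/
def pullbackForm (φ : 𝓕.LeafwiseForm r) : ExteriorForm k F r where
  toFun Y := ⟨hi.pullbackFun φ Y, hi.contMDiff_pullbackFun φ Y⟩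
  map_update_add' {_} Y j x y := by
    ext p
    choose X hX using fun j => hi.exists_relatedAt (Y j) p
    obtain ⟨x', hx⟩ := hi.exists_relatedAt x p
    obtain ⟨y', hy⟩ := hi.exists_relatedAt y p
    have h : ∀ (z' : 𝓕.vecFields) (z : VecField k F),
        VecField.RelatedAt i (z' : VecField n Z) z p →
        hi.pullbackFun φ (update Y j z) p = φ (update X j z') (i p) := fun z' z hz =>
      hi.pullbackFun_eq φ <| (forall_update_iff X (fun l V =>
        VecField.RelatedAt i (V : VecField n Z) (update Y j z l) p)).2
        ⟨by rwa [update_self], fun l hl => by rw [update_of_ne hl]; exact hX l⟩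
    change hi.pullbackFun φ _ p = hi.pullbackFun φ _ p + hi.pullbackFun φ _ p
    rw [h x' x hx, h y' y hy, h (x' + y') (x + y), φ.map_update_add]
    · rfl
    · exact (congrArg₂ (· + ·) hx hy).trans (map_add _ _ _).symm
  map_update_smul' {_} Y j f x := by
    ext p
    choose X hX using fun j => hi.exists_relatedAt (Y j) p
    obtain ⟨x', hx⟩ := hi.exists_relatedAt x p
    have h : ∀ (z' : 𝓕.vecFields) (z : VecField k F),
        VecField.RelatedAt i (z' : VecField n Z) z p →
        hi.pullbackFun φ (update Y j z) p = φ (update X j z') (i p) := fun z' z hz =>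
      hi.pullbackFun_eq φ <| (forall_update_iff X (fun l V =>
        VecField.RelatedAt i (V : VecField n Z) (update Y j z l) p)).2
        ⟨by rwa [update_self], fun l hl => by rw [update_of_ne hl]; exact hX l⟩
    change hi.pullbackFun φ _ p = f p * hi.pullbackFun φ _ p
    -- `f` lives on `F` and need not extend to `Z`. Only its value at `p` matters, so the constant
    -- function `f p` serves instead.
    rw [h x' x hx, h (algebraMap ℝ (SmoothFun n Z) (f p) • x') (f • x), φ.map_update_smul]
    · rfl
    · exact (congrArg (f p • ·) hx).trans (map_smul _ _ _).symm
  map_eq_zero_of_eq' Y a b hab hne := by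
    ext p
    -- The extension is chosen per vector field rather than per index, so that equal arguments
    -- receive equal extensions.
    choose X hX using fun V => hi.exists_relatedAt V p
    change hi.pullbackFun φ Y p = 0
    rw [hi.pullbackFun_eq φ (X := fun j => X (Y j)) fun j => hX (Y j),
      φ.map_eq_zero_of_eq _ (congrArg X hab) hne]
    rfl

lemma pullbackForm_apply (φ : 𝓕.LeafwiseForm r) {Y : Fin r → VecField k F} {p : F}
    {X : Fin r → 𝓕.vecFields} (h : ∀ j, VecField.RelatedAt i (X j : VecField n Z) (Y j) p) :
    hi.pullbackForm φ Y p = φ X (i p) :=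
  hi.pullbackFun_eq φ h

lemma isPullback_iff (φ : 𝓕.LeafwiseForm r) (η : ExteriorForm k F r) :
    𝓕.IsPullback i φ η ↔ hi.pullbackForm φ = η := by
  constructor
  · intro h
    ext Y p
    choose X hX using fun j => hi.exists_relatedAt (Y j) p
    rw [hi.pullbackForm_apply φ hX]
    exact (h p X Y hX).symm
  · rintro rfl p X Y hX
    exact hi.pullbackForm_apply φ hX

/-- Any fields on `Z` related to `Y` at `p` agree at `i p` with leafwise ones, so testing `θ` on
leafwise fields is enough. -/
lemma exteriorForm_isPullback_iff (θ : ExteriorForm n Z r) (η : ExteriorForm k F r) :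
    ExteriorForm.IsPullback i θ η ↔
      hi.pullbackForm (θ.compLinearMap (LieRinehart.inclLinear 𝓕.vecFields)) = η := by
  rw [← isPullback_iff]
  constructor
  · intro h p X Y hX
    exact h p (fun j => X j) Y hX
  · intro h p X Y hX
    choose X' hX' using fun j => hi.exists_relatedAt (Y j) p
    rw [h p X' Y hX']
    exact ExteriorForm.apply_congr θ _ _ fun j => (hX' j).trans (hX j).symm

/-- Pull-back commutes with the Chevalley–Eilenberg differentials. -/
lemma pullbackForm_ceD [T2Space F] (φ : 𝓕.LeafwiseForm r) :
    hi.pullbackForm (LieRinehart.ceD φ) = LieRinehart.ceD (hi.pullbackForm φ) := by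
  ext Y p
  choose X hX using fun j => hi.exists_relatedAt (Y j) p
  -- `X` is related to `Y` only at `p`. Lifting `X` back gives fields `Y'` related to it near `p`
  -- that agree with `Y` at `p`; both sides being forms, `Y` may be replaced by `Y'`.
  choose Y' hY' using fun j => hi.exists_lift (X j) p
  have hYY' : ∀ j, Y j p = Y' j p := fun j =>
    hi.injective_mfderiv p ((hX j).symm.trans (hY' j).self_of_nhds)
  rw [hi.pullbackForm_apply _ hX, ExteriorForm.apply_congr _ Y Y' hYY',
    LieRinehart.ceD_apply, LieRinehart.ceD_apply]
  have hev : ∀ a, (LieRinehart.koszul φ X) (i p) = a ↔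
    ContMDiffMap.evalRingHom (I := 𝓡 n) (n := ∞) (R := ℝ) (i p) (LieRinehart.koszul φ X) = a :=
    fun _ => Iff.rfl
  have hev' : (LieRinehart.koszul (hi.pullbackForm φ) Y') p =
    ContMDiffMap.evalRingHom (I := 𝓡 k) (n := ∞) (R := ℝ) p
      (LieRinehart.koszul (hi.pullbackForm φ) Y') := rfl
  rw [hev, hev', LieRinehart.koszul, LieRinehart.koszul, map_sum, map_sum]
  refine Finset.sum_congr rfl fun a _ => ?_
  simp only [map_mul, map_pow, map_neg, map_one, map_sub, map_sum]
  congr 2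
  -- Equality on a neighbourhood, not just at `p`, is needed because this function is differentiated
  -- along `Y' a`.
  · have h1 : SmoothFun.pullback hi.contMDiff (φ (a.removeNth X)) =ᶠ[𝓝 p]
        hi.pullbackForm φ (a.removeNth Y') := by
      filter_upwards [Filter.eventually_all.2 hY'] with q hq
      exact (hi.pullbackForm_apply φ fun j => hq (a.succAbove j)).symm
    have h2 := (hY' a).self_of_nhds.lie_fun hi.contMDiff (φ (a.removeNth X))
    exact h2.symm.trans (SmoothFun.mvfderiv_congr h1 _)
  · refine Finset.sum_congr rfl fun b _ => ?_
    split_ifs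
    · refine (hi.pullbackForm_apply φ fun j => ?_).symm
      rcases eq_or_ne j b with rfl | hj
      · rw [update_self, update_self]
        exact VecField.RelatedAt.lie hi.contMDiff (hY' a) (hY' j.succ)
      · rw [update_of_ne hj, update_of_ne hj]
        exact (hY' (a.succAbove j)).self_of_nhds
    · rw [map_zero, map_zero]

/-- Pull-back of leafwise forms as a cochain morphism. -/
def pullbackHom [T2Space F] : 𝓕.leafwiseComplex ⟶ deRhamComplex k F :=
  CochainComplex.ofHom
    (fun r => ModuleCat.ofHom
      { toFun := fun φ : 𝓕.LeafwiseForm r => hi.pullbackForm φ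
        map_add' := fun _ _ => rfl
        map_smul' := fun _ _ => rfl })
    (fun r => by
      rw [show 𝓕.leafwiseComplex.d r (r + 1) = _ from LieRinehart.ceComplex_d _ _ _ r,
        show (deRhamComplex k F).d r (r + 1) = _ from LieRinehart.ceComplex_d _ _ _ r]
      ext φ : 2
      exact (hi.pullbackForm_ceD φ).symm)

lemma pullbackForm_constOfIsEmpty (f : SmoothFun n Z) :
    hi.pullbackForm (AlternatingMap.constOfIsEmpty (SmoothFun n Z) 𝓕.vecFields (Fin 0) f) =
      AlternatingMap.constOfIsEmpty (SmoothFun k F) (VecField k F) (Fin 0)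
        (SmoothFun.pullback hi.contMDiff f) := rfl

-- Every vector `di v` is the value of a leafwise field, which annihilates `f`; so `f ∘ i` has zero
-- differential.
include hi in
lemma basicFun_apply_eq [ConnectedSpace F] (f : 𝓕.basicFun) (p q : F) :
    (f : SmoothFun n Z) (i p) = (f : SmoothFun n Z) (i q) := by
  refine SmoothFun.eq_of_mvfderiv_eq_zero (SmoothFun.pullback hi.contMDiff (f : SmoothFun n Z))
    (fun p v => ?_) p q
  obtain ⟨X, hX⟩ := 𝓕.exists_vecField_eq (i p) _ (hi.mfderiv_mem p v)
  rw [SmoothFun.mvfderiv_pullback, ← hX, ← VecField.bracket_fun_apply, f.2 X X.2]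
  rfl

end IsIntegralManifold

/-- Evaluation of the functions constant along the leaves at a point. -/
def basicEval (𝓕 : Foliation n k Z) (z : Z) : 𝓕.basicFun →ₐ[ℝ] ℝ where
  toRingHom := (ContMDiffMap.evalRingHom (I := 𝓡 n) (n := ∞) (R := ℝ) z).comp
    𝓕.basicFun.toSubring.subtype
  commutes' _ := rfl

end Foliation

end

theorem mainTheorem4 {n k : ℕ} {Z F : Type u}
    [TopologicalSpace Z] [ChartedSpace (EuclideanSpace ℝ (Fin n)) Z] [IsManifold (𝓡 n) ∞ Z]
    [T2Space Z] [SecondCountableTopology Z] [ConnectedSpace Z]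
    [TopologicalSpace F] [ChartedSpace (EuclideanSpace ℝ (Fin k)) F] [IsManifold (𝓡 k) ∞ F]
    [T2Space F] [SecondCountableTopology F] [ConnectedSpace F]
    (𝓕 : Foliation n k Z) (i : F → Z) (hi : 𝓕.IsLeaf i) :
    ∃ (P : deRhamComplex n Z ⟶ deRhamComplex k F)
      (Ψ : 𝓕.leafwiseComplex ⟶ deRhamComplex k F),
      (∀ (r : ℕ) (θ : ExteriorForm n Z r) (η : ExteriorForm k F r),
        ExteriorForm.IsPullback i θ η ↔ (P.f r).hom θ = η) ∧
      (∀ (r : ℕ) (φ : 𝓕.LeafwiseForm r) (η : ExteriorForm k F r),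
        𝓕.IsPullback i φ η ↔ (Ψ.f r).hom φ = η) ∧
      (∃ ε : 𝓕.basicFun →ₐ[ℝ] ℝ, ∀ f : 𝓕.basicFun,
        (Ψ.f 0).hom (AlternatingMap.constOfIsEmpty (SmoothFun n Z) 𝓕.vecFields (Fin 0)
            (f : SmoothFun n Z)) =
          AlternatingMap.constOfIsEmpty (SmoothFun k F) (VecField k F) (Fin 0)
            (algebraMap ℝ (SmoothFun k F) (ε f))) ∧
      P = 𝓕.restriction ≫ Ψ ∧
      ∀ r : ℕ, HomologicalComplex.homologyMap P r =
        HomologicalComplex.homologyMap 𝓕.restriction r ≫ HomologicalComplex.homologyMap Ψ r := by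
  have hj : 𝓕.IsIntegralManifold i := hi.toIsIntegralManifold
  -- Any base point gives the same `ε`, since basic functions are constant on the leaf; evaluation
  -- at a point makes it an algebra homomorphism.
  obtain ⟨p₀⟩ := (inferInstance : Nonempty F)
  refine ⟨𝓕.restriction ≫ hj.pullbackHom, hj.pullbackHom,
    fun r θ η => hj.exteriorForm_isPullback_iff θ η, fun r φ η => hj.isPullback_iff φ η,
    ⟨𝓕.basicEval (i p₀), fun f => ?_⟩, rfl, fun r => HomologicalComplex.homologyMap_comp _ _ _⟩
  refine (hj.pullbackForm_constOfIsEmpty (f : SmoothFun n Z)).trans (congrArg _ ?_)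
  ext p
  exact hj.basicFun_apply_eq f p p₀
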